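/- Let $k\ge 1$ be an integer. A $\{k\}$-assignment of a finite graph $G$ is a map $L$ that gives each vertex $x$ a pair $L(x)=(a_x,b_x)$ of elements of $\{0,\dots,k\}$. A weak $\{k\}$-L-dominating function is a function $w:V(G)\to\{0,\dots,k\}$ such that, for each vertex $x$, $w(x)\ge a_x$, and if $w(x)=0$ then $w(N[x])=\sum_{y\in N[x]}w(y)\ge b_x$. Its cost is $\|w\|=\sum_{x\in V(G)}w(x)$, and it is optimal if its cost equals $\gamma_{wkL}(G)$, the minimum of $\|w'\|$ over all weak $\{k\}$-L-dominating functions $w'$. A graph is trivially perfect if it has no induced $P_4$ and no induced $C_4$. A rooted tree $T$ with vertex set $V(G)$ is a model of $G$ if two distinct vertices are adjacent in $G$ exactly when one of them lies on the path in $T$ from the other one to the root. **Theorem.** There is an algorithm which, given $k\ge 1$, a rooted tree $T$ with $n$ vertices that is a model of a (connected) trivially perfect graph $G$, and a $\{k\}$-assignment $L$ of $G$, computes an optimal weak $\{k\}$-L-dominating function of $G$ in $O(k\cdot n)$ time. Here an algorithm is one fixed program of a random access machine in which every arithmetic operation, memory access and test takes one step. The tree is given by an array of parents with respect to an arbitrary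 numbering of the vertices by $0,\dots,n-1$, the labels by two further arrays. The constant in $O(k\cdot n)$ is absolute, that is, independent of $k$, $n$, $T$ and $L$, and all numbers and addresses that occur in the computation are also $O(k\cdot n)$. -/

import Mathlib

open scoped SimpleGraph

/-! ### Trivially perfect graphs and rooted tree models -/

/-- A graph is trivially perfect if it has no induced path `P₄` and no induced cycle `C₄`. -/
def SimpleGraph.IsTriviallyPerfect {V : Type*} (G : SimpleGraph V) : Prop :=
  ¬ (SimpleGraph.pathGraph 4 ⊴ G) ∧ ¬ (SimpleGraph.cycleGraph 4 ⊴ G)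

/-- The rooted tree `T` is a model of the graph `G` on the nodes of `T`: two distinct vertices are
adjacent in `G` if and only if one of them lies on the path in `T` from the other one to the root.
(In Mathlib's `RootedTree`, `⊥` is the root, `Order.pred x` is the parent of `x`, and `y ≤ x` says
that `y` lies on the path from `x` to the root.) -/
def RootedTree.IsModelOf (T : RootedTree) (G : SimpleGraph T) : Prop :=
  ∀ x y : T, G.Adj x y ↔ x ≠ y ∧ (x ≤ y ∨ y ≤ x)

/-! ### Weak `{k}`-`L`-domination -/

section WeakDomination

variable {V : Type*} [Fintype V]

/-- The cost `‖w‖`: the sum of the values of `w` over all vertices. -/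
def domCost {k : ℕ} (w : V → Fin (k + 1)) : ℕ := ∑ x, (w x : ℕ)

open Classical in
/-- `w(N[x])`: the sum of the values of `w` over the closed neighborhood of `x`. -/
noncomputable def closedNbrSum (G : SimpleGraph V) {k : ℕ} (w : V → Fin (k + 1)) (x : V) : ℕ :=
  ∑ y with (y = x ∨ G.Adj x y), (w y : ℕ)

/-- For a `{k}`-assignment `L`, with `L x = (a_x, b_x)`, the function `w : V → {0, …, k}` is weak
`{k}`-`L`-dominating if every vertex `x` satisfies `w x ≥ a_x`, and `w(N[x]) ≥ b_x` when
`w x = 0`. -/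
def IsWeakLDominating (G : SimpleGraph V) {k : ℕ} (L : V → Fin (k + 1) × Fin (k + 1))
    (w : V → Fin (k + 1)) : Prop :=
  ∀ x, (L x).1 ≤ w x ∧ (w x = 0 → ((L x).2 : ℕ) ≤ closedNbrSum G w x)

/-- The weak `{k}`-`L`-domination number: the minimal cost of a weak `{k}`-`L`-dominating
function. -/
noncomputable def weakLDominationNumber (G : SimpleGraph V) {k : ℕ}
    (L : V → Fin (k + 1) × Fin (k + 1)) : ℕ :=
  sInf {c | ∃ w : V → Fin (k + 1), IsWeakLDominating G L w ∧ domCost w = c}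

end WeakDomination

/-! ### A random access machine with a bounded word size and a step count -/

namespace RAM

/-- A state of the machine: the contents of the registers and of the memory cells. -/
structure State where
  reg : ℕ → ℕ
  mem : ℕ → ℕ

/-- Expressions: constants, registers, indirect memory access, and arithmetic. -/
inductive Expr where
  | lit (c : ℕ)
  | reg (r : ℕ)
  | mem (addr : Expr)
  | add (e₁ e₂ : Expr)
  | sub (e₁ e₂ : Expr)
  | mul (e₁ e₂ : Expr)

namespace Expr

/-- The value of an expression; subtraction is truncated at `0`. -/
def eval (s : State) : Expr → ℕ
  | lit c => c
  | reg r => s.reg r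
  | mem e => s.mem (e.eval s)
  | add e₁ e₂ => e₁.eval s + e₂.eval s
  | sub e₁ e₂ => e₁.eval s - e₂.eval s
  | mul e₁ e₂ => e₁.eval s * e₂.eval s

/-- Every constant, access, and arithmetic operation takes one step. -/
def cost : Expr → ℕ
  | lit _ => 1
  | reg _ => 1
  | mem e => e.cost + 1
  | add e₁ e₂ => e₁.cost + e₂.cost + 1
  | sub e₁ e₂ => e₁.cost + e₂.cost + 1
  | mul e₁ e₂ => e₁.cost + e₂.cost + 1

/-- All values (and memory addresses) that occur in the evaluation are at most `W`. -/
def Fits (W : ℕ) (s : State) : Expr → Prop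
  | lit c => c ≤ W
  | reg r => s.reg r ≤ W
  | mem e => e.Fits W s ∧ s.mem (e.eval s) ≤ W
  | add e₁ e₂ => e₁.Fits W s ∧ e₂.Fits W s ∧ e₁.eval s + e₂.eval s ≤ W
  | sub e₁ e₂ => e₁.Fits W s ∧ e₂.Fits W s
  | mul e₁ e₂ => e₁.Fits W s ∧ e₂.Fits W s ∧ e₁.eval s * e₂.eval s ≤ W

end Expr

/-- Programs: `set r e` writes the value of `e` to the register `r`, `store addr e` writes it to the
memory cell at the address `addr`; `ite` and `loop` branch and iterate on whether the value of an
expression is nonzero. -/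
inductive Prog where
  | skip
  | set (r : ℕ) (e : Expr)
  | store (addr e : Expr)
  | seq (p q : Prog)
  | ite (e : Expr) (p q : Prog)
  | loop (e : Expr) (p : Prog)

/-- `Exec W p s t s'`: started in the state `s`, the program `p` halts in the state `s'` after
exactly `t` steps, and no value or address computed or read on the way exceeds `W` (the machine gets
stuck on an overflow). -/
inductive Exec (W : ℕ) : Prog → State → ℕ → State → Prop where
  | skip (s : State) : Exec W .skip s 1 s
  | set (s : State) (r : ℕ) (e : Expr) (he : e.Fits W s) :
      Exec W (.set r e) s (e.cost + 1) ⟨Function.update s.reg r (e.eval s), s.mem⟩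
  | store (s : State) (addr e : Expr) (ha : addr.Fits W s) (he : e.Fits W s) :
      Exec W (.store addr e) s (addr.cost + e.cost + 1)
        ⟨s.reg, Function.update s.mem (addr.eval s) (e.eval s)⟩
  | seq {p q : Prog} {s s₁ s₂ : State} {t₁ t₂ : ℕ} (hp : Exec W p s t₁ s₁)
      (hq : Exec W q s₁ t₂ s₂) : Exec W (.seq p q) s (t₁ + t₂) s₂
  | ite_true {e : Expr} {p q : Prog} {s s₁ : State} {t : ℕ} (he : e.Fits W s) (h : e.eval s ≠ 0)
      (hp : Exec W p s t s₁) : Exec W (.ite e p q) s (e.cost + 1 + t) s₁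
  | ite_false {e : Expr} {p q : Prog} {s s₁ : State} {t : ℕ} (he : e.Fits W s) (h : e.eval s = 0)
      (hq : Exec W q s t s₁) : Exec W (.ite e p q) s (e.cost + 1 + t) s₁
  | loop_true {e : Expr} {p : Prog} {s s₁ s₂ : State} {t₁ t₂ : ℕ} (he : e.Fits W s)
      (h : e.eval s ≠ 0) (hp : Exec W p s t₁ s₁) (hl : Exec W (.loop e p) s₁ t₂ s₂) :
      Exec W (.loop e p) s (e.cost + 1 + t₁ + t₂) s₂
  | loop_false {e : Expr} {p : Prog} {s : State} (he : e.Fits W s) (h : e.eval s = 0) :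
      Exec W (.loop e p) s (e.cost + 1) s

end RAM

/-- The initial state for a rooted tree `T` whose nodes are numbered `0, …, n - 1` by `num`, and a
`{k}`-assignment `L` of its nodes. Register `0` holds `n` and register `1` holds `k`. The memory
holds, in three consecutive blocks of length `n`, the number of the parent of every node (the root
is its own parent), the first labels and the second labels. All else is `0`. -/
def inputState (T : RootedTree) {n : ℕ} (num : T ≃ Fin n) (k : ℕ)
    (L : T → Fin (k + 1) × Fin (k + 1)) : RAM.State where
  reg := fun r => [n, k].getD r 0
  mem := fun i =>
    (List.ofFn (fun v : Fin n => (num (Order.pred (num.symm v)) : ℕ)) ++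
      List.ofFn (fun v : Fin n => ((L (num.symm v)).1 : ℕ)) ++
      List.ofFn (fun v : Fin n => ((L (num.symm v)).2 : ℕ))).getD i 0

/-- The state `s` holds the function `w` in the `n` memory cells that follow the input. -/
def IsOutput {T : RootedTree} {n : ℕ} (num : T ≃ Fin n) {k : ℕ} (w : T → Fin (k + 1))
    (s : RAM.State) : Prop :=
  ∀ x : T, s.mem (3 * n + num x) = w x

/-! ### Reasoning about programs -/

namespace RAM

/-! The closed neighbourhood of a node of the tree consists of its proper ancestors and its subtree
(`closedNbrSum_eq`). A subtree therefore sees the values outside it only through the sum over the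
ancestors of its root, and since all `b`-labels are at most `k`, this sum may be truncated at `k`.
Let `f x s` be the least cost of the subtree of `x` when the truncated sum is `s`, and let `F` be
the sum of the functions `f c` over the children `c` of `x`.

A positive value `v` at `x` costs `v + F (min k (s + v))`; the best one is found from suffix minima
of `F`. The value `0` needs `a = 0`, and the part below must have weight at least `F s` and at least
`b - s`. It is not clear that `max (F s) (b - s)` is attained, but this does not matter: `F` is
antitone, so the value `1` costs at most `1 + F s`, and `0` is strictly better only if `b - s ≤ F
s`. In that case an optimal solution below already satisfies the requirement at `x`. This is
`IsChoice.spec`; the summand `a` in `zeroCost` excludes the choice of `0` when `a` is positive. The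
recursion `step` thus bounds every feasible function from below (`recursion_le_subtreeSum`), and
values that attain the minima from the root downwards give equality (`optimal_of_isChoice`).

The machine strips leaves with a queue. Each node has a row of `k + 1` entries in which the costs of
its children accumulate; a dequeued node computes its suffix minima in one downward scan and adds
its costs to the row of its parent. The reversed queue visits parents before children, and there
each value is chosen by one upward scan. Each node thus takes `O(k)` steps in either direction. All
table entries are at most `k * n`, by `recursion_le`. The proof of correctness combines loop
invariants with a weakest precondition calculus for loop bodies. -/

/-- Started in the state `s`, the program `p` halts after at most `T` steps, within the word size
`W`, in a state that satisfies `Q`. -/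
def Runs (W : ℕ) (p : Prog) (s : State) (T : ℕ) (Q : State → Prop) : Prop :=
  ∃ t s', Exec W p s t s' ∧ t ≤ T ∧ Q s'

lemma Runs.mono {W : ℕ} {p : Prog} {s : State} {T T' : ℕ} {Q Q' : State → Prop}
    (h : Runs W p s T Q) (hT : T ≤ T') (hQ : ∀ s', Q s' → Q' s') : Runs W p s T' Q' := by
  obtain ⟨t, s', h1, h2, h3⟩ := h
  exact ⟨t, s', h1, h2.trans hT, hQ s' h3⟩

lemma Runs.seq {W : ℕ} {p q : Prog} {s : State} {T₁ T₂ : ℕ} {Q R : State → Prop}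
    (hp : Runs W p s T₁ R) (hq : ∀ s', R s' → Runs W q s' T₂ Q) :
    Runs W (.seq p q) s (T₁ + T₂) Q := by
  obtain ⟨t₁, s₁, h1, h2, h3⟩ := hp
  obtain ⟨t₂, s₂, h4, h5, h6⟩ := hq s₁ h3
  exact ⟨t₁ + t₂, s₂, .seq h1 h4, by omega, h6⟩

/-- A loop with an invariant `I m`, where `m` bounds the number of the remaining iterations. -/
lemma Runs.loop {W : ℕ} {e : Expr} {p : Prog} {T : ℕ} {Q : State → Prop} (I : ℕ → State → Prop)
    (hfits : ∀ m s, I m s → e.Fits W s)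
    (hexit : ∀ m s, I m s → e.eval s = 0 → Q s)
    (hbody : ∀ m s, I m s → e.eval s ≠ 0 → ∃ m', m = m' + 1 ∧ Runs W p s T (I m'))
    (m : ℕ) {s : State} (hs : I m s) :
    Runs W (.loop e p) s (m * (T + e.cost + 1) + e.cost + 1) Q := by
  induction m generalizing s with
  | zero =>
    by_cases h : e.eval s = 0
    · exact ⟨_, s, .loop_false (hfits _ s hs) h, by omega, hexit _ s hs h⟩
    · obtain ⟨m', h', -⟩ := hbody _ s hs h
      omega
  | succ m ih =>
    by_cases h : e.eval s = 0
    · exact ⟨_, s, .loop_false (hfits _ s hs) h, by nlinarith, hexit _ s hs h⟩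
    · obtain ⟨m', h', t₁, s₁, h1, h2, h3⟩ := hbody _ s hs h
      obtain rfl : m = m' := by omega
      obtain ⟨t₂, s₂, h4, h5, h6⟩ := ih h3
      exact ⟨_, s₂, .loop_true (hfits _ s hs) h h1 h4, by linarith, h6⟩

/-- A loop that counts a register down to `0`. -/
lemma Runs.countdown {W r : ℕ} {p : Prog} {T : ℕ} (I : ℕ → State → Prop)
    (hreg : ∀ m s, I m s → s.reg r = m ∧ m ≤ W)
    (hbody : ∀ m s, I (m + 1) s → Runs W p s T (I m))
    (m : ℕ) {s : State} (hs : I m s) :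
    Runs W (.loop (.reg r) p) s (m * (T + 2) + 2) (I 0) := by
  refine Runs.loop I (fun m s h => ?_) (fun m s h h0 => ?_) (fun m s h h0 => ?_) m hs
  · simpa [Expr.Fits, (hreg m s h).1] using (hreg m s h).2
  · have := (hreg m s h).1
    simp only [Expr.eval] at h0
    obtain rfl : m = 0 := by omega
    exact h
  · have := (hreg m s h).1
    simp only [Expr.eval] at h0
    obtain ⟨m', rfl⟩ : ∃ m', m = m' + 1 := ⟨m - 1, by omega⟩
    exact ⟨m', rfl, hbody m' s h⟩

/-- The weakest precondition of a program without loops. -/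
def Prog.wp (W : ℕ) : Prog → (State → Prop) → State → Prop
  | .skip, Q, s => Q s
  | .set r e, Q, s => e.Fits W s ∧ Q ⟨Function.update s.reg r (e.eval s), s.mem⟩
  | .store a e, Q, s =>
      a.Fits W s ∧ e.Fits W s ∧ Q ⟨s.reg, Function.update s.mem (a.eval s) (e.eval s)⟩
  | .seq p q, Q, s => p.wp W (q.wp W Q) s
  | .ite e p q, Q, s => e.Fits W s ∧ (e.eval s ≠ 0 → p.wp W Q s) ∧ (e.eval s = 0 → q.wp W Q s)
  | .loop _ _, _, _ => False

/-- The maximal number of steps of a program without loops. -/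
def Prog.maxCost : Prog → ℕ
  | .skip => 1
  | .set _ e => e.cost + 1
  | .store a e => a.cost + e.cost + 1
  | .seq p q => p.maxCost + q.maxCost
  -- Both branches are counted; an upper bound suffices.
  | .ite e p q => e.cost + 1 + (p.maxCost + q.maxCost)
  | .loop _ _ => 0

lemma Runs.of_wp {W : ℕ} {p : Prog} {s : State} {T : ℕ} {Q : State → Prop} (h : p.wp W Q s)
    (hT : p.maxCost ≤ T) : Runs W p s T Q := by
  refine Runs.mono (T := p.maxCost) ?_ hT fun _ => id
  clear hT
  induction p generalizing s Q with
  | skip => exact ⟨_, _, .skip s, le_rfl, h⟩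
  | set r e => exact ⟨_, _, .set s r e h.1, le_rfl, h.2⟩
  | store a e => exact ⟨_, _, .store s a e h.1 h.2.1, le_rfl, h.2.2⟩
  | seq p q hp hq => exact (hp h).seq fun s' => hq
  | ite e p q hp hq =>
    by_cases h0 : e.eval s = 0
    · obtain ⟨t, s', h1, h2, h3⟩ := hq (h.2.2 h0)
      exact ⟨_, s', .ite_false h.1 h0 h1, by simp only [Prog.maxCost]; omega, h3⟩
    · obtain ⟨t, s', h1, h2, h3⟩ := hp (h.2.1 h0)
      exact ⟨_, s', .ite_true h.1 h0 h1, by simp only [Prog.maxCost]; omega, h3⟩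
  | loop e p => exact h.elim

end RAM

/-! ### The recursion for the value of a node -/

namespace WeakDom

/-- The minimum of `j + F (u + j)` over all `j` with `u + j ≤ k`. -/
def sufMin (F : ℕ → ℕ) (k u : ℕ) : ℕ :=
  if u < k then min (F u) (1 + sufMin F k (u + 1)) else F u
termination_by k - u

lemma sufMin_of_lt {F : ℕ → ℕ} {k u : ℕ} (h : u < k) :
    sufMin F k u = min (F u) (1 + sufMin F k (u + 1)) := by
  rw [sufMin, if_pos h]

lemma sufMin_self (F : ℕ → ℕ) (k : ℕ) : sufMin F k k = F k := by
  rw [sufMin, if_neg (lt_irrefl k)]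

lemma sufMin_le (F : ℕ → ℕ) (k u : ℕ) : sufMin F k u ≤ F u := by
  rw [sufMin]; split_ifs <;> simp

lemma sufMin_le_add {F : ℕ → ℕ} {k : ℕ} (j : ℕ) {u : ℕ} (h : u + j ≤ k) :
    sufMin F k u ≤ j + F (u + j) := by
  induction j generalizing u with
  | zero => simpa using sufMin_le F k u
  | succ j ih =>
    rw [sufMin_of_lt (by omega)]
    have := ih (u := u + 1) (by omega)
    rw [show u + 1 + j = u + (j + 1) by ring] at this
    omega

/-- It suffices to compare neighbours: `sufMin F k (u + 1)` is at most `F (u + 1) ≤ F u`, hence at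
most both terms of the minimum at `u`. -/
lemma sufMin_antitone {F : ℕ → ℕ} {k : ℕ} (hF : AntitoneOn F (Set.Iic k)) {u v : ℕ} (huv : u ≤ v)
    (hv : v ≤ k) : sufMin F k v ≤ sufMin F k u := by
  suffices h : ∀ u < k, sufMin F k (u + 1) ≤ sufMin F k u by
    induction v, huv using Nat.le_induction with
    | base => exact le_rfl
    | succ v huv ih => exact (h v hv).trans (ih (by omega))
  intro u hu
  have := sufMin_le F k (u + 1)
  have := hF (Set.mem_Iic.2 hu.le) (Set.mem_Iic.2 (Nat.succ_le_of_lt hu)) (Nat.le_succ u)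
  rw [sufMin_of_lt hu]
  simp only [Nat.succ_eq_add_one] at this
  omega

/-- The minimal cost of a subtree whose root has the value `0`. -/
def zeroCost (a b : ℕ) (F : ℕ → ℕ) (s : ℕ) : ℕ := max (F s) (b - s) + a

/-- The minimal cost of a subtree whose root has a positive value. -/
def posCost (k a : ℕ) (F : ℕ → ℕ) (s : ℕ) : ℕ := max a 1 + sufMin F k (min k (s + max a 1))

/-- The minimal cost of a subtree whose root has the label `(a, b)`, when `F` gives the minimal
cost of all of the subtree but its root; the argument is the sum of the values of the proper
ancestors, truncated at `k`. -/
def step (k a b : ℕ) (F : ℕ → ℕ) (s : ℕ) : ℕ := min (zeroCost a b F s) (posCost k a F s)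

/-- The value `v` of the root attains the minimum in `step`. -/
def IsChoice (k a b : ℕ) (F : ℕ → ℕ) (s v : ℕ) : Prop :=
  (zeroCost a b F s < posCost k a F s ∧ v = 0) ∨
    (posCost k a F s ≤ zeroCost a b F s ∧ ∃ j, min k (s + max a 1) + j ≤ k ∧ v = max a 1 + j ∧
      sufMin F k (min k (s + max a 1)) = j + F (min k (s + max a 1) + j))

/-- A larger sum above never makes the rest of the subtree dearer. This estimate lets a positive
root compete with a zero root. -/
lemma posCost_le {k a : ℕ} {F : ℕ → ℕ} (hF : AntitoneOn F (Set.Iic k)) {s : ℕ} (hs : s ≤ k) :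
    posCost k a F s ≤ max a 1 + F s := by
  have := (sufMin_le F k (min k (s + max a 1))).trans
    (hF (Set.mem_Iic.2 hs) (Set.mem_Iic.2 (min_le_left _ _)) (by omega))
  unfold posCost
  omega

lemma step_antitone {k a b : ℕ} {F : ℕ → ℕ} (hF : AntitoneOn F (Set.Iic k)) :
    AntitoneOn (step k a b F) (Set.Iic k) := by
  intro s hs t ht hst
  have h1 := hF hs ht hst
  have h2 := sufMin_antitone hF (u := min k (s + max a 1)) (v := min k (t + max a 1)) (by omega)
    (min_le_left _ _)
  simp only [step, zeroCost, posCost]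
  omega

lemma step_le_add {k a b : ℕ} {F : ℕ → ℕ} (hF : AntitoneOn F (Set.Iic k)) (hk : 1 ≤ k)
    (ha : a ≤ k) {s : ℕ} (hs : s ≤ k) : step k a b F s ≤ k + F s := by
  have := posCost_le (a := a) hF hs
  unfold step
  omega

/-- Every feasible value of the root costs at least `step`. -/
lemma step_le {k a b : ℕ} {F : ℕ → ℕ} {s v R : ℕ} (hav : a ≤ v) (hR : F (min k (s + v)) ≤ R)
    (hs : s ≤ k) (h0 : v = 0 → b - s ≤ R) : step k a b F s ≤ v + R := by
  rcases Nat.eq_zero_or_pos v with rfl | hv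
  · have := h0 rfl
    rw [add_zero, min_eq_right hs] at hR
    simp only [step, zeroCost]
    omega
  · refine (min_le_right _ _).trans ?_
    -- Only the part of `v` that survives the truncation at `k` is compared; any excess is wasted.
    have := sufMin_le_add (F := F) (k := k) (u := min k (s + max a 1))
      (min k (s + v) - min k (s + max a 1)) (by omega)
    rw [show min k (s + max a 1) + (min k (s + v) - min k (s + max a 1)) = min k (s + v) by omega]
      at this
    unfold posCost
    omega

/-- If `0` wins strictly, `posCost_le` gives `max (F s) (b - s) + a < max a 1 + F s`, so `a = 0` and
`b - s ≤ F s`: the zero root has no deficit to be repaired. A tie goes to the positive value, which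
is always feasible. -/
lemma IsChoice.spec {k a b : ℕ} {F : ℕ → ℕ} {s v : ℕ} (hF : AntitoneOn F (Set.Iic k)) (hk : 1 ≤ k)
    (ha : a ≤ k) (hs : s ≤ k) (hv : IsChoice k a b F s v) :
    a ≤ v ∧ v ≤ k ∧ step k a b F s = v + F (min k (s + v)) ∧ (v = 0 → b ≤ s + F s) := by
  have hP := posCost_le (a := a) hF hs
  rcases hv with ⟨h1, rfl⟩ | ⟨h1, j, h2, rfl, h4⟩
  · rw [add_zero, min_eq_right hs]
    simp only [step]
    simp only [zeroCost] at h1 ⊢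
    omega
  · refine ⟨by omega, by omega, ?_, by omega⟩
    rw [step, min_eq_right h1, posCost, h4,
      show min k (s + (max a 1 + j)) = min k (s + max a 1) + j by omega]
    ring

/-! ### Sums over subtrees and over ancestors -/

section Tree

set_option linter.unusedSectionVars false

variable {α : Type*} [PartialOrder α] [OrderBot α] [PredOrder α] [IsPredArchimedean α] [Fintype α]

open Classical in
/-- The children of a node of a rooted tree. -/
noncomputable def children (x : α) : Finset α := {c | c ≠ ⊥ ∧ Order.pred c = x}

lemma mem_children {x c : α} : c ∈ children x ↔ c ≠ ⊥ ∧ Order.pred c = x := by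
  simp [children]

lemma lt_of_mem_children {x c : α} (h : c ∈ children x) : x < c := by
  rw [mem_children] at h
  rw [← h.2]
  exact Order.pred_lt_of_not_isMin (by simpa [isMin_iff_eq_bot] using h.1)

lemma lt_iff_le_of_mem_children {x c y : α} (h : c ∈ children x) : y < c ↔ y ≤ x := by
  rw [mem_children] at h
  rw [← h.2]
  exact (Order.le_pred_iff_of_not_isMin (by simpa [isMin_iff_eq_bot] using h.1)).symm

/-- The path of parents from `y` up to `x` passes through a child of `x` just before its end. -/
lemma exists_child_le {x y : α} (h : x < y) : ∃ c ∈ children x, c ≤ y := by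
  obtain ⟨n, hn⟩ := h.le.exists_pred_iterate
  induction n generalizing y with
  | zero => exact absurd hn.symm h.ne
  | succ n ih =>
    rw [Function.iterate_succ_apply] at hn
    have hy : y ≠ ⊥ := (bot_le.trans_lt h).ne'
    have hx : x ≤ Order.pred y := Order.le_pred_of_lt h
    rcases hx.eq_or_lt with hx | hx
    · exact ⟨y, mem_children.2 ⟨hy, hx.symm⟩, le_rfl⟩
    · obtain ⟨c, hc, hcy⟩ := ih hx hn
      exact ⟨c, hc, hcy.trans (Order.pred_le y)⟩

open Classical in
/-- The sum of `g` over the subtree of `x`. -/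
noncomputable def subtreeSum (g : α → ℕ) (x : α) : ℕ := ∑ y with x ≤ y, g y

open Classical in
/-- The sum of `g` over the proper ancestors of `x`. -/
noncomputable def ancestorSum (g : α → ℕ) (x : α) : ℕ := ∑ y with y < x, g y

lemma subtreeSum_eq (g : α → ℕ) (x : α) :
    subtreeSum g x = g x + ∑ c ∈ children x, subtreeSum g c := by
  classical
  have hdisj : (children x : Set α).PairwiseDisjoint
      fun c => Finset.univ.filter fun y => c ≤ y := by
    intro c hc c' hc' hne
    rw [Finset.mem_coe] at hc hc'
    simp only [Function.onFun, Finset.disjoint_left, Finset.mem_filter_univ]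
    intro y hy hy'
    -- The ancestors of `y` form a chain, so two children of `x` above a common `y` are comparable;
    -- the smaller would be at most `x`.
    rcases le_total_of_directed hy' hy with h | h
    · exact (lt_of_mem_children hc).not_ge ((lt_iff_le_of_mem_children hc').1 (lt_of_le_of_ne h (by tauto)))
    · exact (lt_of_mem_children hc').not_ge
        ((lt_iff_le_of_mem_children hc).1 (lt_of_le_of_ne h (by tauto)))
  unfold subtreeSum
  rw [← Finset.sum_biUnion hdisj, ← Finset.sum_insert]
  · congr 1
    ext y
    simp only [Finset.mem_filter_univ, Finset.mem_insert, Finset.mem_biUnion]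
    constructor
    · intro h
      rcases h.eq_or_lt with h | h
      · exact .inl h.symm
      · exact .inr (exists_child_le h)
    · rintro (rfl | ⟨c, hc, hcy⟩)
      · exact le_rfl
      · exact (lt_of_mem_children hc).le.trans hcy
  · simp only [Finset.mem_biUnion, Finset.mem_filter_univ, not_exists, not_and]
    exact fun c hc => (lt_of_mem_children hc).not_ge

lemma ancestorSum_bot (g : α → ℕ) : ancestorSum g ⊥ = 0 := by
  simp [ancestorSum]

lemma ancestorSum_child (g : α → ℕ) {x c : α} (h : c ∈ children x) :
    ancestorSum g c = ancestorSum g x + g x := by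
  classical
  unfold ancestorSum
  rw [add_comm, ← Finset.sum_insert (by simp)]
  congr 1
  ext y
  simp [lt_iff_le_of_mem_children h, le_iff_eq_or_lt]

/-- A rooted tree admits the recursion `step`. -/
lemma exists_recursion (k : ℕ) (a b : α → ℕ) : ∃ f : α → ℕ → ℕ, ∀ x,
    f x = step k (a x) (b x) fun s => ∑ c ∈ children x, f c s := by
  have wf : WellFounded (fun x y : α => x > y) := wellFounded_gt
  -- Well-founded recursion along `>`, so that the children are available before their parent.
  refine ⟨wf.fix (C := fun _ => ℕ → ℕ) fun x ih => step k (a x) (b x) fun s =>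
    ∑ c : {c // c ∈ children x}, ih c (lt_of_mem_children c.2) s, fun x => ?_⟩
  rw [wf.fix_eq]
  congr 1
  funext s
  exact Finset.sum_coe_sort (children x) fun c => wf.fix (C := fun _ => ℕ → ℕ) _ c s

/-! ### Monotonicity, size and optimality of the recursion -/

variable {k : ℕ} {a b : α → ℕ} {f : α → ℕ → ℕ}

lemma antitoneOn_sum {ι : Type*} {g : ι → ℕ → ℕ} {t : Finset ι} {S : Set ℕ}
    (h : ∀ i ∈ t, AntitoneOn (g i) S) : AntitoneOn (fun s => ∑ i ∈ t, g i s) S :=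
  fun _ hx _ hy hxy => Finset.sum_le_sum fun i hi => h i hi hx hy hxy

lemma recursion_antitone (hf : ∀ x, f x = step k (a x) (b x) fun s => ∑ c ∈ children x, f c s)
    (x : α) : AntitoneOn (f x) (Set.Iic k) := by
  induction x using WellFoundedGT.induction with
  | ind x ih =>
    rw [hf x]
    exact step_antitone (antitoneOn_sum fun c hc => ih c (lt_of_mem_children hc))

lemma recursion_sum_antitone
    (hf : ∀ x, f x = step k (a x) (b x) fun s => ∑ c ∈ children x, f c s) (x : α) :
    AntitoneOn (fun s => ∑ c ∈ children x, f c s) (Set.Iic k) :=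
  antitoneOn_sum fun c _ => recursion_antitone hf c

/-- Each node adds at most `k` to the cost, by `step_le_add`. This keeps the table entries within
the word size. -/
lemma recursion_le (hf : ∀ x, f x = step k (a x) (b x) fun s => ∑ c ∈ children x, f c s)
    (hk : 1 ≤ k) (ha : ∀ x, a x ≤ k) {s : ℕ} (hs : s ≤ k) (x : α) :
    f x s ≤ k * subtreeSum (fun _ => 1) x := by
  induction x using WellFoundedGT.induction with
  | ind x ih =>
    rw [hf x, subtreeSum_eq, mul_add, mul_one, Finset.mul_sum]
    refine (step_le_add (recursion_sum_antitone hf x) hk (ha x) hs).trans ?_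
    gcongr with c hc
    exact ih c (lt_of_mem_children hc)

lemma subtreeSum_one_le (x : α) : subtreeSum (fun _ => 1) x ≤ Fintype.card α := by
  classical
  rw [subtreeSum, Finset.sum_const, smul_eq_mul, mul_one]
  exact Finset.card_le_univ _

lemma recursion_sum_le (hf : ∀ x, f x = step k (a x) (b x) fun s => ∑ c ∈ children x, f c s)
    (hk : 1 ≤ k) (ha : ∀ x, a x ≤ k) {s : ℕ} (hs : s ≤ k) (x : α) :
    ∑ c ∈ children x, f c s ≤ k * Fintype.card α := by
  calc ∑ c ∈ children x, f c s ≤ ∑ c ∈ children x, k * subtreeSum (fun _ => 1) c :=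
        Finset.sum_le_sum fun c _ => recursion_le hf hk ha hs c
    _ ≤ k * subtreeSum (fun _ => 1) x := by
        rw [subtreeSum_eq _ x, ← Finset.mul_sum]
        gcongr
        omega
    _ ≤ k * Fintype.card α := Nat.mul_le_mul_left k (subtreeSum_one_le x)

/-- The recursion bounds the cost of a feasible function from below. -/
lemma recursion_le_subtreeSum
    (hf : ∀ x, f x = step k (a x) (b x) fun s => ∑ c ∈ children x, f c s)
    (hb : ∀ x, b x ≤ k) {w : α → ℕ} (haw : ∀ x, a x ≤ w x)
    (hw : ∀ x, w x = 0 → b x ≤ ancestorSum w x + subtreeSum w x) (x : α) :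
    f x (min k (ancestorSum w x)) ≤ subtreeSum w x := by
  induction x using WellFoundedGT.induction with
  | ind x ih =>
    rw [hf x, subtreeSum_eq]
    refine step_le (haw x) (Finset.sum_le_sum fun c hc => ?_) (min_le_left _ _) fun h0 => ?_
    · have := ih c (lt_of_mem_children hc)
      rwa [ancestorSum_child w hc, show min k (ancestorSum w x + w x) =
        min k (min k (ancestorSum w x) + w x) by omega] at this
    · have h1 := hw x h0
      -- Since `b x ≤ k`, truncating the ancestor sum at `k` does not change whether the requirement
      -- holds.
      have h2 := hb x
      rw [subtreeSum_eq, h0] at h1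
      omega

/-- A function that attains the minimum of the recursion at each node attains it for subtrees. -/
lemma subtreeSum_eq_recursion {w : α → ℕ}
    (hw : ∀ x, f x (min k (ancestorSum w x)) =
      w x + ∑ c ∈ children x, f c (min k (min k (ancestorSum w x) + w x))) (x : α) :
    subtreeSum w x = f x (min k (ancestorSum w x)) := by
  induction x using WellFoundedGT.induction with
  | ind x ih =>
    rw [subtreeSum_eq, hw x]
    congr 1
    refine Finset.sum_congr rfl fun c hc => ?_
    rw [ih c (lt_of_mem_children hc), ancestorSum_child w hc]
    congr 1
    omega

/-- The neighbours in the model are exactly the comparable nodes: those strictly above `x`, and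
those at or below `x`. -/
lemma closedNbrSum_eq {G : SimpleGraph α} (hG : ∀ x y : α, G.Adj x y ↔ x ≠ y ∧ (x ≤ y ∨ y ≤ x))
    {k : ℕ} (w : α → Fin (k + 1)) (x : α) :
    closedNbrSum G w x = ancestorSum (fun y => (w y : ℕ)) x + subtreeSum (fun y => (w y : ℕ)) x := by
  classical
  unfold closedNbrSum ancestorSum subtreeSum
  rw [← Finset.sum_union]
  · congr 1
    ext y
    simp only [hG, Finset.mem_filter_univ, Finset.mem_union, lt_iff_le_and_ne]
    constructor
    · rintro (rfl | ⟨h1, h2 | h2⟩)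
      · exact .inr le_rfl
      · exact .inr h2
      · exact .inl ⟨h2, h1.symm⟩
    · rintro (⟨h1, h2⟩ | h1)
      · exact .inr ⟨h2.symm, .inr h1⟩
      · by_cases h : y = x
        · exact .inl h
        · exact .inr ⟨Ne.symm h, .inl h1⟩
  · rw [Finset.disjoint_left]
    intro y hy hy'
    simp only [Finset.mem_filter_univ] at hy hy'
    exact hy.not_ge hy'

lemma domCost_eq {k : ℕ} (w : α → Fin (k + 1)) :
    domCost w = subtreeSum (fun y => (w y : ℕ)) (⊥ : α) := by
  simp [domCost, subtreeSum]

/-- Choosing the values greedily from the root to the leaves is optimal. -/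
theorem optimal_of_isChoice {G : SimpleGraph α}
    (hG : ∀ x y : α, G.Adj x y ↔ x ≠ y ∧ (x ≤ y ∨ y ≤ x)) {k : ℕ} (hk : 1 ≤ k)
    (L : α → Fin (k + 1) × Fin (k + 1)) {f : α → ℕ → ℕ}
    (hf : ∀ x, f x = step k (L x).1 (L x).2 fun s => ∑ c ∈ children x, f c s)
    (w : α → Fin (k + 1))
    (hw : ∀ x, IsChoice k (L x).1 (L x).2 (fun s => ∑ c ∈ children x, f c s)
      (min k (ancestorSum (fun y => (w y : ℕ)) x)) (w x)) :
    IsWeakLDominating G L w ∧ domCost w = weakLDominationNumber G L := by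
  have ha : ∀ x, ((L x).1 : ℕ) ≤ k := fun x => Nat.lt_succ_iff.1 (L x).1.2
  have hb : ∀ x, ((L x).2 : ℕ) ≤ k := fun x => Nat.lt_succ_iff.1 (L x).2.2
  have hspec := fun x => (hw x).spec (recursion_sum_antitone hf x) hk (ha x) (min_le_left _ _)
  have hsum := subtreeSum_eq_recursion (f := f) (k := k) (w := fun y => (w y : ℕ)) fun x => by
    rw [hf x]; exact (hspec x).2.2.1
  have hdom : IsWeakLDominating G L w := by
    refine fun x => ⟨Fin.le_def.2 (hspec x).1, fun h0 => ?_⟩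
    have h0' : (w x : ℕ) = 0 := by rw [h0]; rfl
    have h1 := (hspec x).2.2.2 h0'
    rw [closedNbrSum_eq hG, hsum x, hf x, (hspec x).2.2.1, h0', add_zero,
      min_eq_right (min_le_left _ _)]
    beta_reduce at h1 ⊢
    omega
  refine ⟨hdom, le_antisymm (le_csInf ⟨_, w, hdom, rfl⟩ ?_) (Nat.sInf_le ⟨w, hdom, rfl⟩)⟩
  rintro _ ⟨w', hw', rfl⟩
  -- At the root there are no proper ancestors, so the lower bound for any competitor is the value
  -- that `w` attains.
  have hlow := recursion_le_subtreeSum hf hb (w := fun y => (w' y : ℕ))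
    (fun x => Fin.le_def.1 (hw' x).1) (fun x h0 => by
      rw [← closedNbrSum_eq hG]
      exact (hw' x).2 (Fin.ext h0)) ⊥
  rw [domCost_eq, domCost_eq, hsum]
  rwa [ancestorSum_bot, ← ancestorSum_bot fun y => (w y : ℕ)] at hlow

end Tree

end WeakDom

/-! ### Notation for expressions and programs -/

namespace RAM

instance : Add Expr := ⟨.add⟩
instance : Sub Expr := ⟨.sub⟩
instance : Mul Expr := ⟨.mul⟩
instance (c : ℕ) : OfNat Expr c := ⟨.lit c⟩

@[simp] lemma Expr.eval_add (s : State) (x y : Expr) : (x + y).eval s = x.eval s + y.eval s := rfl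
@[simp] lemma Expr.eval_sub (s : State) (x y : Expr) : (x - y).eval s = x.eval s - y.eval s := rfl
@[simp] lemma Expr.eval_mul (s : State) (x y : Expr) : (x * y).eval s = x.eval s * y.eval s := rfl
@[simp] lemma Expr.eval_ofNat (s : State) (c : ℕ) : Expr.eval s (no_index (OfNat.ofNat c)) = c := rfl
@[simp] lemma Expr.eval_reg (s : State) (r : ℕ) : (Expr.reg r).eval s = s.reg r := rfl
@[simp] lemma Expr.eval_mem (s : State) (x : Expr) : x.mem.eval s = s.mem (x.eval s) := rfl
@[simp] lemma Expr.fits_add {W : ℕ} {s : State} {x y : Expr} :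
    (x + y).Fits W s ↔ x.Fits W s ∧ y.Fits W s ∧ x.eval s + y.eval s ≤ W := Iff.rfl
@[simp] lemma Expr.fits_sub {W : ℕ} {s : State} {x y : Expr} :
    (x - y).Fits W s ↔ x.Fits W s ∧ y.Fits W s := Iff.rfl
@[simp] lemma Expr.fits_mul {W : ℕ} {s : State} {x y : Expr} :
    (x * y).Fits W s ↔ x.Fits W s ∧ y.Fits W s ∧ x.eval s * y.eval s ≤ W := Iff.rfl
@[simp] lemma Expr.fits_ofNat {W : ℕ} {s : State} {c : ℕ} :
    Expr.Fits W s (no_index (OfNat.ofNat c)) ↔ c ≤ W := Iff.rfl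
@[simp] lemma Expr.fits_reg {W : ℕ} {s : State} {r : ℕ} :
    (Expr.reg r).Fits W s ↔ s.reg r ≤ W := Iff.rfl
@[simp] lemma Expr.fits_mem {W : ℕ} {s : State} {x : Expr} :
    x.mem.Fits W s ↔ x.Fits W s ∧ s.mem (x.eval s) ≤ W := Iff.rfl

/-- The minimum of two expressions. -/
def Expr.min (x y : Expr) : Expr := x - (x - y)

/-- The maximum of two expressions. -/
def Expr.max (x y : Expr) : Expr := x + (y - x)

@[simp] lemma Expr.eval_min (s : State) (x y : Expr) :
    (x.min y).eval s = Min.min (x.eval s) (y.eval s) := by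
  simp only [Expr.min, eval_sub]; omega
@[simp] lemma Expr.eval_max (s : State) (x y : Expr) :
    (x.max y).eval s = Max.max (x.eval s) (y.eval s) := by
  simp only [Expr.max, eval_sub, eval_add]; omega
@[simp] lemma Expr.fits_min {W : ℕ} {s : State} {x y : Expr} :
    (x.min y).Fits W s ↔ x.Fits W s ∧ y.Fits W s := by
  simp only [Expr.min, fits_sub]; tauto
@[simp] lemma Expr.fits_max {W : ℕ} {s : State} {x y : Expr} :
    (x.max y).Fits W s ↔ x.Fits W s ∧ y.Fits W s ∧ Max.max (x.eval s) (y.eval s) ≤ W := by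
  simp only [Expr.max, fits_sub, fits_add, eval_sub]
  rw [show x.eval s + (y.eval s - x.eval s) = Max.max (x.eval s) (y.eval s) by omega]
  tauto

infixr:30 " ;; " => Prog.seq

end RAM

/-! ### The layout of the memory -/

namespace WeakDom

/-- The address of the row of tables for the node `j`. -/
def row (n k j : ℕ) : ℕ := 7 * n + 2 + 2 * (j * (k + 1))

lemma le_row (n k j : ℕ) : 7 * n + 2 ≤ row n k j := Nat.le_add_right _ _

/-- Uniqueness of quotient and remainder modulo `k + 1`. -/
lemma row_inj {n k i j s t : ℕ} (hs : s ≤ k) (ht : t ≤ k) (h : row n k i + 2 * s = row n k j + 2 * t) :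
    i = j ∧ s = t := by
  have h' : i * (k + 1) + s = j * (k + 1) + t := by unfold row at h; omega
  have h1 := congrArg (· / (k + 1)) h'
  have h2 := congrArg (· % (k + 1)) h'
  simp only [mul_comm _ (k + 1), Nat.mul_add_div (Nat.succ_pos k),
    Nat.mul_add_mod, Nat.div_eq_of_lt (Nat.lt_succ_of_le hs), Nat.div_eq_of_lt (Nat.lt_succ_of_le ht),
    Nat.mod_eq_of_lt (Nat.lt_succ_of_le hs), Nat.mod_eq_of_lt (Nat.lt_succ_of_le ht)] at h1 h2
  omega

/-- The largest address is `9 * n + 2 * k * n + 2 * k + 3`; the constant `16` is attained at `n = k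
= 1`. -/
lemma row_add_le {n k j s : ℕ} (hn : 1 ≤ n) (hk : 1 ≤ k) (hj : j ≤ n) (hs : s ≤ k) :
    row n k j + 2 * s + 1 ≤ 16 * (k * n) := by
  have := Nat.mul_le_mul_right (k + 1) hj
  unfold row
  nlinarith [mul_le_mul hn hk (by omega) (by omega)]

/-- The memory `m` holds the given arrays and tables. -/
structure Rep (n k : ℕ) (par a b out deg queue acc : ℕ → ℕ) (F M : ℕ → ℕ → ℕ) (m : ℕ → ℕ) :
    Prop where
  par : ∀ j < n, m j = par j
  a : ∀ j < n, m (n + j) = a j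
  b : ∀ j < n, m (2 * n + j) = b j
  out : ∀ j < n, m (3 * n + j) = out j
  -- This array, `acc` and the tables have `n + 1` entries or rows: the index `n` stands for a
  -- fictitious parent of the root.
  deg : ∀ j ≤ n, m (4 * n + j) = deg j
  queue : ∀ j < n, m (5 * n + 1 + j) = queue j
  acc : ∀ j ≤ n, m (6 * n + 1 + j) = acc j
  F : ∀ j ≤ n, ∀ s ≤ k, m (row n k j + 2 * s) = F j s
  M : ∀ j ≤ n, ∀ s ≤ k, m (row n k j + 2 * s + 1) = M j s

/-! ### Effect of a single memory write -/

namespace Rep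

variable {n k : ℕ} {par a b out deg queue acc : ℕ → ℕ} {F M : ℕ → ℕ → ℕ} {m : ℕ → ℕ}

/-- Only entries within range are represented, so an updated array can be replaced by a closed form
that agrees there. -/
lemma congr {par' deg' : ℕ → ℕ} {F' M' : ℕ → ℕ → ℕ}
    (h : Rep n k par a b out deg queue acc F M m)
    (hpar : ∀ j < n, par j = par' j := by intros; rfl)
    (hdeg : ∀ j ≤ n, deg j = deg' j := by intros; rfl)
    (hF : ∀ j ≤ n, ∀ s ≤ k, F j s = F' j s := by intros; rfl)
    (hM : ∀ j ≤ n, ∀ s ≤ k, M j s = M' j s := by intros; rfl) :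
    Rep n k par' a b out deg' queue acc F' M' m :=
  { h with
    par := fun j hj => (h.par j hj).trans (hpar j hj)
    deg := fun j hj => (h.deg j hj).trans (hdeg j hj)
    F := fun j hj s hs => (h.F j hj s hs).trans (hF j hj s hs)
    M := fun j hj s hs => (h.M j hj s hs).trans (hM j hj s hs) }

/-- The blocks are disjoint, so a write changes only its own array. The same scheme serves all the
following writes; in the tables, costs and suffix minima are told apart by the parity of the offset.
-/
lemma set_par (h : Rep n k par a b out deg queue acc F M m) {i : ℕ} (hi : i < n) (x : ℕ) :
    Rep n k (Function.update par i x) a b out deg queue acc F M (Function.update m i x) := by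
  refine ⟨fun j hj => ?_, fun j hj => ?_, fun j hj => ?_, fun j hj => ?_, fun j hj => ?_, fun j hj => ?_, fun j hj => ?_,
    fun j hj t ht => ?_, fun j hj t ht => ?_⟩
  on_goal 1 => simp only [Function.update_apply, h.par j hj]
  all_goals rw [Function.update_of_ne (by have := le_row n k j; have := le_row n k i; unfold row at *; omega)]
  exacts [h.a j hj, h.b j hj, h.out j hj, h.deg j hj, h.queue j hj, h.acc j hj, h.F j hj t ht, h.M j hj t ht]

lemma set_out (h : Rep n k par a b out deg queue acc F M m) {i : ℕ} (hi : i < n) (x : ℕ) :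
    Rep n k par a b (Function.update out i x) deg queue acc F M
      (Function.update m (3 * n + i) x) := by
  refine ⟨fun j hj => ?_, fun j hj => ?_, fun j hj => ?_, fun j hj => ?_, fun j hj => ?_, fun j hj => ?_, fun j hj => ?_,
    fun j hj t ht => ?_, fun j hj t ht => ?_⟩
  on_goal 4 => simp only [Function.update_apply, Nat.add_left_cancel_iff, h.out j hj]
  all_goals rw [Function.update_of_ne (by have := le_row n k j; have := le_row n k i; unfold row at *; omega)]
  exacts [h.par j hj, h.a j hj, h.b j hj, h.deg j hj, h.queue j hj, h.acc j hj, h.F j hj t ht, h.M j hj t ht]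

lemma set_deg (h : Rep n k par a b out deg queue acc F M m) {i : ℕ} (hi : i ≤ n) (x : ℕ) :
    Rep n k par a b out (Function.update deg i x) queue acc F M
      (Function.update m (4 * n + i) x) := by
  refine ⟨fun j hj => ?_, fun j hj => ?_, fun j hj => ?_, fun j hj => ?_, fun j hj => ?_, fun j hj => ?_, fun j hj => ?_,
    fun j hj t ht => ?_, fun j hj t ht => ?_⟩
  on_goal 5 => simp only [Function.update_apply, Nat.add_left_cancel_iff, h.deg j hj]
  all_goals rw [Function.update_of_ne (by have := le_row n k j; have := le_row n k i; unfold row at *; omega)]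
  exacts [h.par j hj, h.a j hj, h.b j hj, h.out j hj, h.queue j hj, h.acc j hj, h.F j hj t ht, h.M j hj t ht]

lemma set_queue (h : Rep n k par a b out deg queue acc F M m) {i : ℕ} (hi : i < n) (x : ℕ) :
    Rep n k par a b out deg (Function.update queue i x) acc F M
      (Function.update m (5 * n + 1 + i) x) := by
  refine ⟨fun j hj => ?_, fun j hj => ?_, fun j hj => ?_, fun j hj => ?_, fun j hj => ?_, fun j hj => ?_, fun j hj => ?_,
    fun j hj t ht => ?_, fun j hj t ht => ?_⟩
  on_goal 6 => simp only [Function.update_apply, Nat.add_left_cancel_iff, h.queue j hj]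
  all_goals rw [Function.update_of_ne (by have := le_row n k j; have := le_row n k i; unfold row at *; omega)]
  exacts [h.par j hj, h.a j hj, h.b j hj, h.out j hj, h.deg j hj, h.acc j hj, h.F j hj t ht, h.M j hj t ht]

lemma set_acc (h : Rep n k par a b out deg queue acc F M m) {i : ℕ} (hi : i ≤ n) (x : ℕ) :
    Rep n k par a b out deg queue (Function.update acc i x) F M
      (Function.update m (6 * n + 1 + i) x) := by
  refine ⟨fun j hj => ?_, fun j hj => ?_, fun j hj => ?_, fun j hj => ?_, fun j hj => ?_, fun j hj => ?_, fun j hj => ?_,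
    fun j hj t ht => ?_, fun j hj t ht => ?_⟩
  on_goal 7 => simp only [Function.update_apply, Nat.add_left_cancel_iff, h.acc j hj]
  all_goals rw [Function.update_of_ne (by have := le_row n k j; have := le_row n k i; unfold row at *; omega)]
  exacts [h.par j hj, h.a j hj, h.b j hj, h.out j hj, h.deg j hj, h.queue j hj, h.F j hj t ht, h.M j hj t ht]

lemma set_F (h : Rep n k par a b out deg queue acc F M m) {i s : ℕ} (hs : s ≤ k)
    (x : ℕ) : Rep n k par a b out deg queue acc (Function.update F i (Function.update (F i) s x)) M
      (Function.update m (row n k i + 2 * s) x) := by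
  refine ⟨fun j hj => ?_, fun j hj => ?_, fun j hj => ?_, fun j hj => ?_, fun j hj => ?_, fun j hj => ?_, fun j hj => ?_,
    fun j hj t ht => ?_, fun j hj t ht => ?_⟩
  on_goal 8 =>
    by_cases hji : j = i ∧ t = s
    · obtain ⟨rfl, rfl⟩ := hji
      simp
    · rw [Function.update_of_ne fun h' => hji (row_inj (n := n) ht hs (by omega)), h.F j hj t ht]
      by_cases hj' : j = i
      · subst hj'
        simp [show t ≠ s by tauto]
      · simp [hj']
  all_goals rw [Function.update_of_ne (by have := le_row n k j; have := le_row n k i; unfold row at *; omega)]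
  exacts [h.par j hj, h.a j hj, h.b j hj, h.out j hj, h.deg j hj, h.queue j hj, h.acc j hj, h.M j hj t ht]

lemma set_M (h : Rep n k par a b out deg queue acc F M m) {i s : ℕ} (hs : s ≤ k)
    (x : ℕ) : Rep n k par a b out deg queue acc F (Function.update M i (Function.update (M i) s x))
      (Function.update m (row n k i + 2 * s + 1) x) := by
  refine ⟨fun j hj => ?_, fun j hj => ?_, fun j hj => ?_, fun j hj => ?_, fun j hj => ?_, fun j hj => ?_, fun j hj => ?_,
    fun j hj t ht => ?_, fun j hj t ht => ?_⟩
  on_goal 9 =>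
    by_cases hji : j = i ∧ t = s
    · obtain ⟨rfl, rfl⟩ := hji
      simp
    · rw [Function.update_of_ne fun h' => hji (row_inj (n := n) ht hs (by omega)), h.M j hj t ht]
      by_cases hj' : j = i
      · subst hj'
        simp [show t ≠ s by tauto]
      · simp [hj']
  all_goals rw [Function.update_of_ne (by have := le_row n k j; have := le_row n k i; unfold row at *; omega)]
  exacts [h.par j hj, h.a j hj, h.b j hj, h.out j hj, h.deg j hj, h.queue j hj, h.acc j hj, h.F j hj t ht]

end Rep

open RAM RAM.Expr

variable {n k W : ℕ} {par a b out deg queue acc : ℕ → ℕ} {F M : ℕ → ℕ → ℕ}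

/-! ### Redirecting the root and counting the children -/

/-- Replace the parent of the root by `n` and count the children of all nodes. -/
def countChildren : Prog :=
  .set 2 (reg 0) ;;
  .loop (reg 2) (
    .set 2 (reg 2 - 1) ;;
    .set 5 (mem (reg 2)) ;;
    .set 5 (reg 5 + (reg 0 - reg 5) * (1 - ((reg 5 - reg 2) + (reg 2 - reg 5)))) ;;
    .store (reg 2) (reg 5) ;;
    .set 6 (mem (4 * reg 0 + reg 5) + 1) ;;
    .store (4 * reg 0 + reg 5) (reg 6))

/-- With truncated subtraction, `(p - v) + (v - p)` is the distance of `p` and `v`, so one minus it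
is the indicator of `p = v`. -/
lemma redirect_eq {n p v : ℕ} (hp : p < n) :
    p + (n - p) * (1 - ((p - v) + (v - p))) = if p = v then n else p := by
  split_ifs with h
  · subst h; simp; omega
  · rw [show 1 - ((p - v) + (v - p)) = 0 by omega]; simp

lemma card_filter_Ico_succ {n m : ℕ} (hm : m < n) (P : ℕ → Prop) [DecidablePred P] :
    ((Finset.Ico m n).filter P).card =
      ((Finset.Ico (m + 1) n).filter P).card + if P m then 1 else 0 := by
  rw [← Finset.insert_Ico_add_one_left_eq_Ico hm, Finset.filter_insert]
  split_ifs
  · rw [Finset.card_insert_of_notMem (by simp)]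
  · rfl

/-- Invariant: the nodes from `m` on have been redirected and counted at their new parents. -/
lemma countChildren_runs {par' : ℕ → ℕ} (hn : 1 ≤ n) (hW : 100 * n ≤ W)
    (hpar : ∀ j < n, par j < n) (hpar' : ∀ j < n, par' j = if par j = j then n else par j)
    (hdeg : ∀ j ≤ n, deg j = 0) {s : State} (h0 : s.reg 0 = n) (h1 : s.reg 1 = k)
    (h : Rep n k par a b out deg queue acc F M s.mem) :
    Runs W countChildren s (100 * n) fun s => s.reg 0 = n ∧ s.reg 1 = k ∧
      Rep n k par' a b out (fun j => ((Finset.range n).filter fun v => par' v = j).card)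
        queue acc F M s.mem := by
  let I : ℕ → State → Prop := fun m s => s.reg 0 = n ∧ s.reg 1 = k ∧ s.reg 2 = m ∧ m ≤ n ∧
    Rep n k (fun j => if m ≤ j then par' j else par j) a b out
      (fun j => ((Finset.Ico m n).filter fun v => par' v = j).card) queue acc F M s.mem
  refine Runs.mono (T := 2 + (n * (60 + 2) + 2)) (Q := I 0)
    (Runs.seq (R := I n) (Runs.of_wp ?_ (by decide)) fun s hs => Runs.countdown I ?_ ?_ n hs)
    (by omega) ?_
  · simp only [Prog.wp, fits_reg, eval_reg, h0]
    refine ⟨by omega, by simp [h0], by simp [h1], by simp, le_rfl, ?_⟩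
    exact { h with
      par := fun j hj => by simp [h.par j hj, hj.not_ge]
      deg := fun j hj => by simp [h.deg j hj, hdeg j hj] }
  · exact fun m s hs => ⟨hs.2.2.1, by have := hs.2.2.2.1; omega⟩
  · rintro m s ⟨h0, h1, h2, hm, h⟩
    have hp := hpar m hm
    have hp' := hpar' m hm
    have e1 : s.mem m = par m := by simpa using h.par m hm
    have hle : par' m ≤ n := by rw [hp']; split_ifs <;> omega
    have hmul : (n - par m) * (1 - ((par m - m) + (m - par m))) ≤ n := by
      have := redirect_eq (v := m) hp
      split_ifs at this <;> omega
    have h' := h.set_par hm (par' m)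
    have hcard := Finset.card_filter_le (Finset.Ico (m + 1) n) fun v => par' v = par' m
    rw [Nat.card_Ico] at hcard
    refine Runs.of_wp ?_ (by decide)
    simp +decide only [Prog.wp, fits_reg, fits_add, fits_sub, fits_mul, fits_mem, fits_ofNat, eval_reg,
      eval_add, eval_sub, eval_mul, eval_mem, eval_ofNat, Function.update_self, ne_eq,
      Function.update_of_ne,
      h0, h2, Nat.add_sub_cancel, e1, redirect_eq hp, ← hp', h'.deg _ hle]
    and_intros
    any_goals omega
    any_goals (simp [h0, h1]; done)
    refine (h'.set_deg hle _).congr (fun j hj => ?_) (fun j hj => ?_)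
    · rw [Function.update_apply]
      split_ifs with h1 h2 h2 <;> first | omega | (subst h1; rfl)
    · rw [card_filter_Ico_succ hm, Function.update_apply]
      split_ifs <;> simp_all
  · rintro s ⟨h0, h1, -, -, h⟩
    exact ⟨h0, h1, by simpa using h⟩

/-! ### Collecting the leaves -/

/-- Write the nodes without children to the queue. -/
def collectLeaves : Prog :=
  (.set 2 (reg 0) ;; .set 3 0) ;;
  .loop (reg 2) (
    .set 2 (reg 2 - 1) ;;
    .ite (mem (4 * reg 0 + reg 2)) .skip
      (.store (5 * reg 0 + 1 + reg 3) (reg 2) ;;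
       .set 3 (reg 3 + 1)))

lemma collectLeaves_runs (hn : 1 ≤ n) (hW : 100 * n ≤ W) (hdeg : ∀ j ≤ n, deg j ≤ n) {s : State}
    (h0 : s.reg 0 = n) (h1 : s.reg 1 = k)
    (h : Rep n k par a b out deg queue acc F M s.mem) :
    Runs W collectLeaves s (100 * n) fun s => s.reg 0 = n ∧ s.reg 1 = k ∧ ∃ q,
      Rep n k par a b out deg q acc F M s.mem ∧ s.reg 3 ≤ n ∧ (∀ j < s.reg 3, q j < n) ∧
      (∀ i < s.reg 3, ∀ j < s.reg 3, q i = q j → i = j) ∧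
      ∀ v < n, (∃ j < s.reg 3, q j = v) ↔ deg v = 0 := by
  let I : ℕ → State → Prop := fun m s => s.reg 0 = n ∧ s.reg 1 = k ∧ s.reg 2 = m ∧ m ≤ n ∧ ∃ q,
      Rep n k par a b out deg q acc F M s.mem ∧ s.reg 3 + m ≤ n ∧
      (∀ j < s.reg 3, q j < n) ∧
      (∀ i < s.reg 3, ∀ j < s.reg 3, q i = q j → i = j) ∧
      ∀ v < n, (∃ j < s.reg 3, q j = v) ↔ m ≤ v ∧ deg v = 0
  refine Runs.mono (T := 4 + (n * (40 + 2) + 2)) (Q := I 0)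
    (Runs.seq (R := I n) (Runs.of_wp ?_ (by decide)) fun s hs => Runs.countdown I ?_ ?_ n hs)
    (by omega) ?_
  · simp +decide only [Prog.wp, fits_reg, fits_ofNat, eval_reg, eval_ofNat, h0]
    refine ⟨by omega, by omega, by simp [h0], by simp [h1], by simp, le_rfl, queue, h, ?_⟩
    simp only [Function.update_self]
    refine ⟨by omega, by omega, by omega, fun v hv => ?_⟩
    simp [hv]
  · exact fun m s hs => ⟨hs.2.2.1, by have := hs.2.2.2.1; omega⟩
  · rintro m s ⟨h0, h1, h2, hm, q, h, ht, hq, hinj, hmem⟩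
    have h3 := hdeg m (by omega)
    -- The scan goes downwards, so every queued number exceeds `m`, and appending `m` keeps the
    -- queue injective.
    have hlow : ∀ j < s.reg 3, m + 1 ≤ q j := fun j hj => ((hmem _ (hq j hj)).1 ⟨j, hj, rfl⟩).1
    refine Runs.of_wp ?_ (by decide)
    simp +decide only [Prog.wp, fits_reg, fits_add, fits_sub, fits_mul, fits_mem, fits_ofNat,
      eval_reg, eval_add, eval_sub, eval_mul, eval_mem, eval_ofNat, Function.update_self, ne_eq,
      Function.update_of_ne, h0, h2, Nat.add_sub_cancel, h.deg m (by omega)]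
    refine ⟨by omega, by omega, fun hd => ?_, fun hd => ?_⟩
    · refine ⟨by simp [h0], by simp [h1], by simp, by omega, q, h, ?_⟩
      simp +decide only [Function.update_of_ne, ne_eq]
      refine ⟨by omega, hq, hinj, fun v hv => ?_⟩
      rw [hmem v hv]
      refine ⟨fun h => ⟨by omega, h.2⟩, fun h => ⟨?_, h.2⟩⟩
      rcases h.1.eq_or_lt with rfl | h'
      · exact absurd h.2 hd
      · exact h'
    · refine ⟨by omega, by omega, by omega, ?_⟩
      refine ⟨by simp [h0], by simp [h1], by simp, by omega, _, h.set_queue (by omega) m, ?_⟩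
      simp +decide only [Function.update_self]
      refine ⟨by omega, fun j hj => ?_, fun i hi j hj => ?_, fun v hv => ?_⟩
      · rw [Function.update_apply]
        split_ifs
        · omega
        · exact hq j (by omega)
      · have h4 := hlow i
        have h5 := hlow j
        rw [Function.update_apply, Function.update_apply]
        split_ifs with h6 h7 h7
        · omega
        · intro; have := h5 (by omega); omega
        · intro; have := h4 (by omega); omega
        · exact hinj i (by omega) j (by omega)
      · constructor
        · rintro ⟨j, hj, rfl⟩
          by_cases hj' : j = s.reg 3
          · subst hj'; simpa using hd
          · rw [Function.update_of_ne hj'] at hv ⊢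
            have := (hmem _ hv).1 ⟨j, by omega, rfl⟩
            omega
        · rintro ⟨h6, h7⟩
          rcases h6.eq_or_lt with rfl | h8
          · exact ⟨s.reg 3, by omega, by simp⟩
          · obtain ⟨j, hj, rfl⟩ := (hmem v hv).2 ⟨h8, h7⟩
            exact ⟨j, by omega, by rw [Function.update_of_ne (by omega)]⟩
  · rintro s ⟨h0, h1, -, -, q, h, ht, hq, hinj, hmem⟩
    exact ⟨h0, h1, q, h, ht, hq, hinj, by simpa using hmem⟩

/-! ### The tables of a node -/

/-- Compute the table of suffix minima of a node, and add its costs to the table of its parent. -/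
def updateTables : Prog :=
  (.set 6 (reg 1 + 1) ;; .set 12 (mem (reg 7 + 2 * reg 1))) ;;
  .loop (reg 6) (
    .set 6 (reg 6 - 1) ;;
    .set 13 (mem (reg 7 + 2 * reg 6)) ;;
    .set 12 ((reg 13).min (1 + reg 12)) ;;
    .store (reg 7 + 2 * reg 6 + 1) (reg 12) ;;
    .set 14 ((reg 1).min (reg 6 + reg 10)) ;;
    .set 14 (reg 10 + mem (reg 7 + 2 * reg 14 + 1)) ;;
    .set 15 ((reg 13).max (reg 11 - reg 6) + reg 9) ;;
    .set 15 (mem (reg 8 + 2 * reg 6) + (reg 15).min (reg 14)) ;;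
    .store (reg 8 + 2 * reg 6) (reg 15))

/-- Starting the running minimum with `F k` is harmless: at `k` it yields `min (F k) (1 + F k) = F
k`. -/
lemma min_sufMin_succ (F : ℕ → ℕ) {k m : ℕ} (hm : m ≤ k) :
    min (F m) (1 + if m + 1 ≤ k then sufMin F k (m + 1) else F k) = sufMin F k m := by
  split_ifs with h
  · rw [sufMin_of_lt h]
  · obtain rfl : m = k := by omega
    rw [sufMin_self]
    omega

lemma update_update_ite_succ (G : ℕ → ℕ → ℕ) (g : ℕ → ℕ) (i m j t : ℕ) :
    Function.update (fun j t => if j = i ∧ m + 1 ≤ t then g t else G j t) i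
      (Function.update (fun t => if i = i ∧ m + 1 ≤ t then g t else G i t) m (g m)) j t =
      if j = i ∧ m ≤ t then g t else G j t := by
  rcases eq_or_ne j i with rfl | hj
  · rcases eq_or_ne t m with rfl | ht
    · simp
    · simp [ht, show m < t ↔ m ≤ t by omega]
  · simp [hj]

/-- The columns are treated from `k` down to `0`. The suffix minimum needed for a positive root lies
in column `min k (m + max (a v) 1) ≥ m`, so it is already stored. As `p ≠ v`, adding to the row of
the parent does not disturb the costs being read. -/
lemma updateTables_runs {v p : ℕ} (hn : 1 ≤ n) (hk : 1 ≤ k) (hW : 100 * (k * n) ≤ W) (hv : v ≤ n)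
    (hp : p ≤ n) (hpv : p ≠ v) (ha : a v ≤ k) (hb : b v ≤ k) (hF : ∀ s ≤ k, F v s ≤ k * n)
    (hFp : ∀ s ≤ k, F p s + step k (a v) (b v) (F v) s ≤ k * n) {s : State}
    (h0 : s.reg 0 = n) (h1 : s.reg 1 = k) (h7 : s.reg 7 = row n k v) (h8 : s.reg 8 = row n k p)
    (h9 : s.reg 9 = a v) (h10 : s.reg 10 = max (a v) 1) (h11 : s.reg 11 = b v)
    (h : Rep n k par a b out deg queue acc F M s.mem) :
    Runs W updateTables s (300 * k) fun s' => (∀ r < 6, s'.reg r = s.reg r) ∧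
      Rep n k par a b out deg queue acc
        (Function.update F p fun t => F p t + step k (a v) (b v) (F v) t)
        (Function.update M v (sufMin (F v) k)) s'.mem := by
  have hkn : k ≤ k * n := Nat.le_mul_of_pos_right k hn
  have hnk : n ≤ k * n := Nat.le_mul_of_pos_left n hk
  let I : ℕ → State → Prop := fun m s' =>
    (∀ r < 12, r ≠ 6 → s'.reg r = s.reg r) ∧ s'.reg 6 = m ∧ m ≤ k + 1 ∧
    (s'.reg 12 = if m ≤ k then sufMin (F v) k m else F v k) ∧
    Rep n k par a b out deg queue acc
      (fun j t => if j = p ∧ m ≤ t then F p t + step k (a v) (b v) (F v) t else F j t)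
      (fun j t => if j = v ∧ m ≤ t then sufMin (F v) k t else M j t) s'.mem
  refine Runs.mono (T := 20 + ((k + 1) * (100 + 2) + 2)) (Q := I 0)
    (Runs.seq (R := I (k + 1)) (Runs.of_wp ?_ (by decide)) fun s hs =>
      Runs.countdown I ?_ ?_ (k + 1) hs)
    (by omega) ?_
  · have hrow := row_add_le hn hk hv le_rfl
    have hFk := hF k le_rfl
    simp +decide only [Prog.wp, fits_reg, fits_add, fits_mul, fits_mem, fits_ofNat,
      eval_reg, eval_add, eval_mul, eval_mem, eval_ofNat, ne_eq,
      Function.update_of_ne, h1, h7, h.F v hv k le_rfl]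
    refine ⟨by omega, by omega, fun r hr hr' => ?_, by simp, by simp, by simp,
      h.congr (hF := fun j hj t ht => ?_) (hM := fun j hj t ht => ?_)⟩
    · dsimp only
      rw [Function.update_of_ne (by omega), Function.update_of_ne (by omega)]
    · rw [if_neg (by omega)]
    · rw [if_neg (by omega)]
  · exact fun m s hs => ⟨hs.2.1, by have := hs.2.2.1; omega⟩
  · rintro m s' ⟨hr, h6, hm, h12, h'⟩
    replace hm : m ≤ k := by omega
    have hu : min k (m + max (a v) 1) ≤ k := min_le_left _ _
    have hrv := row_add_le hn hk hv hm
    have hrp := row_add_le hn hk hp hm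
    have hru := row_add_le hn hk hv hu
    have hFm := hF m hm
    have hFpm := hFp m hm
    have hsu := sufMin_le (F v) k m
    simp only [step, zeroCost, posCost] at hFpm
    have hs1 : (1 + if m + 1 ≤ k then sufMin (F v) k (m + 1) else F v k) ≤ 1 + k * n := by
      split_ifs with hmk
      · have := (sufMin_le (F v) k (m + 1)).trans (hF _ hmk); omega
      · have := hF k le_rfl; omega
    have hsuu := (sufMin_le (F v) k _).trans (hF _ hu)
    have h'' := h'.set_M (i := v) hm (sufMin (F v) k m)
    have e1 := h'.F v hv m hm
    -- For `m = k` the column read is the one just written, so the store has to precede this access.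
    have e2 : Function.update s'.mem (row n k v + 2 * m + 1) (sufMin (F v) k m)
        (row n k v + 2 * min k (m + max (a v) 1) + 1) =
          sufMin (F v) k (min k (m + max (a v) 1)) := by
      rw [h''.M v hv _ hu, Function.update_self, Function.update_apply]
      split_ifs with h1 h2
      · rw [h1]
      · rfl
      · omega
    have e3 := h''.F p hp m hm
    rw [if_neg (by omega)] at e1 e3
    have g1 := (hr 1 (by omega) (by omega)).trans h1
    have g7 := (hr 7 (by omega) (by omega)).trans h7
    have g8 := (hr 8 (by omega) (by omega)).trans h8
    have g9 := (hr 9 (by omega) (by omega)).trans h9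
    have g10 := (hr 10 (by omega) (by omega)).trans h10
    have g11 := (hr 11 (by omega) (by omega)).trans h11
    refine Runs.of_wp ?_ (by decide)
    simp +decide only [Prog.wp, fits_reg, fits_add, fits_sub, fits_mul, fits_mem, fits_ofNat,
      fits_min, fits_max, eval_min, eval_max,
      eval_reg, eval_add, eval_sub, eval_mul, eval_mem, eval_ofNat, Function.update_self, ne_eq,
      Function.update_of_ne, g1, g7, g8, g9, g10, g11, h6, Nat.add_sub_cancel, h12, e1,
      min_sufMin_succ (F v) hm, e2, e3]
    and_intros
    any_goals omega
    · intro r hr1 hr2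
      dsimp only
      rw [← hr r hr1 hr2]
      iterate 7 rw [Function.update_of_ne (by omega)]
    · simp
    · simp [hm]
    · exact (h''.set_F hm _).congr
        (hF := fun j _ t _ => update_update_ite_succ F
          (fun t => F p t + step k (a v) (b v) (F v) t) p m j t)
        (hM := fun j _ t _ => update_update_ite_succ M (sufMin (F v) k) v m j t)
  · rintro s' ⟨hr, -, -, -, h⟩
    refine ⟨fun r hr' => hr r (by omega) (by omega), h.congr (hF := fun j hj t ht => ?_)
      (hM := fun j hj t ht => ?_)⟩ <;>
    · rw [Function.update_apply]
      simp only [zero_le, and_true]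
      split_ifs <;> rfl

/-! ### Leaf stripping -/

/-- The queue `q` holds `t` nodes of which the first `i`, the set `P`, have been processed. It
consists of the nodes all of whose children have been processed. -/
structure IsQueue (n : ℕ) (par q : ℕ → ℕ) (t i : ℕ) (P : Finset ℕ) : Prop where
  le : i ≤ t
  lt : ∀ j < t, q j < n
  inj : ∀ i < t, ∀ j < t, q i = q j → i = j
  mem : ∀ v, v ∈ P ↔ ∃ j < i, q j = v
  ready : ∀ v < n, (∃ j < t, q j = v) ↔ ∀ u < n, par u = v → u ∈ P
  order : ∀ j < i, ∀ u < n, par u = q j → ∃ j' < j, q j' = u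

namespace IsQueue

variable {n : ℕ} {par q : ℕ → ℕ} {t i : ℕ} {P : Finset ℕ}

lemma le_size (h : IsQueue n par q t i P) : t ≤ n := by
  have := Finset.card_le_card_of_injOn (s := Finset.range t) (t := Finset.range n) q
    (fun j hj => by simpa using h.lt j (by simpa using hj))
    (fun i hi j hj => h.inj i (by simpa using hi) j (by simpa using hj))
  simpa using this

lemma subset (h : IsQueue n par q t i P) : P ⊆ Finset.range n := by
  intro v hv
  obtain ⟨j, hj, rfl⟩ := (h.mem v).1 hv
  exact Finset.mem_range.2 (h.lt j (hj.trans_le h.le))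

lemma card (h : IsQueue n par q t i P) : P.card = i := by
  have : P = (Finset.range i).image q := by
    ext v; simp [h.mem]
  rw [this, Finset.card_image_of_injOn, Finset.card_range]
  intro a ha b hb hab
  have := h.le
  simp only [Finset.coe_range, Set.mem_Iio] at ha hb
  exact h.inj a (by omega) b (by omega) hab

/-- As long as there are unprocessed nodes, the queue holds one of them. -/
lemma lt_length (h : IsQueue n par q t i P) {d : ℕ → ℕ} (hd : ∀ v < n, par v < n → d (par v) < d v)
    (hi : i < n) : i < t := by
  have hne : (Finset.range n \ P).Nonempty := by
    rw [← Finset.card_pos, Finset.card_sdiff_of_subset h.subset, h.card, Finset.card_range]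
    omega
  -- Take a deepest unprocessed node, with `d` as depth. Its children are deeper, hence processed,
  -- so it is in the queue.
  obtain ⟨v, hv, hmax⟩ := Finset.exists_max_image _ d hne
  rw [Finset.mem_sdiff, Finset.mem_range] at hv
  obtain ⟨j, hj, hjv⟩ := (h.ready v hv.1).2 fun u hu huv => by
    by_contra huP
    have h1 := hmax u (by simp [hu, huP])
    have h2 := hd u hu (by omega)
    rw [huv] at h2
    omega
  by_contra hit
  exact hv.2 ((h.mem v).2 ⟨j, by omega, hjv⟩)

lemma notMem (h : IsQueue n par q t i P) (hi : i < t) : q i ∉ P := by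
  intro hP
  obtain ⟨j, hj, hj'⟩ := (h.mem _).1 hP
  have := h.inj j (by omega) i hi hj'
  omega

lemma children_mem (h : IsQueue n par q t i P) (hi : i < t) {u : ℕ} (hu : u < n)
    (hpar : par u = q i) : u ∈ P :=
  (h.ready _ (h.lt i hi)).1 ⟨i, hi, rfl⟩ u hu hpar

lemma mem_insert_iff (h : IsQueue n par q t i P) (v : ℕ) :
    v ∈ insert (q i) P ↔ ∃ j < i + 1, q j = v := by
  rw [Finset.mem_insert, h.mem]
  constructor
  · rintro (rfl | ⟨j, hj, rfl⟩)
    · exact ⟨i, by omega, rfl⟩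
    · exact ⟨j, by omega, rfl⟩
  · rintro ⟨j, hj, rfl⟩
    by_cases hji : j = i
    · exact .inl (by rw [hji])
    · exact .inr ⟨j, by omega, rfl⟩

lemma order_succ (h : IsQueue n par q t i P) (hi : i < t) :
    ∀ j < i + 1, ∀ u < n, par u = q j → ∃ j' < j, q j' = u := by
  intro j hj u hu hpar
  by_cases hji : j = i
  · subst hji
    exact (h.mem u).1 (h.children_mem hi hu hpar)
  · exact h.order j (by omega) u hu hpar

/-- Processing a node can affect the readiness of its parent only. -/
lemma children_insert_iff {v : ℕ} (hv : v ≠ par (q i)) :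
    (∀ u < n, par u = v → u ∈ insert (q i) P) ↔ ∀ u < n, par u = v → u ∈ P := by
  refine forall₃_congr fun u _ huv => ?_
  rw [Finset.mem_insert, or_iff_right]
  rintro rfl
  exact hv huv.symm

/-- The current node is itself an unprocessed child of its parent, so the parent is not ready yet.
-/
lemma parent_notMem (h : IsQueue n par q t i P) (hi : i < t) (hp : par (q i) < n) :
    ¬ ∃ j < t, q j = par (q i) := by
  rw [h.ready _ hp]
  exact fun h' => h.notMem hi (h' _ (h.lt i hi) rfl)

/-- Process the next node, when its parent becomes ready. -/
lemma push (h : IsQueue n par q t i P) (hi : i < t) (hp : par (q i) < n)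
    (hr : ∀ u < n, par u = par (q i) → u ∈ insert (q i) P) :
    IsQueue n par (Function.update q t (par (q i))) (t + 1) (i + 1) (insert (q i) P) := by
  have hnot := h.parent_notMem hi hp
  have hq : ∀ j < t, Function.update q t (par (q i)) j = q j := fun j hj =>
    Function.update_of_ne hj.ne _ _
  have hmem : ∀ v, (∃ j < t + 1, Function.update q t (par (q i)) j = v) ↔
      v = par (q i) ∨ ∃ j < t, q j = v := by
    intro v
    constructor
    · rintro ⟨j, hj, rfl⟩
      by_cases hjt : j = t
      · subst hjt; simp
      · exact .inr ⟨j, by omega, (hq j (by omega)).symm⟩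
    · rintro (rfl | ⟨j, hj, rfl⟩)
      · exact ⟨t, by omega, by simp⟩
      · exact ⟨j, by omega, hq j hj⟩
  refine ⟨by omega, fun j hj => ?_, fun a ha b hb => ?_, fun v => ?_, fun v hv => ?_,
    fun j hj u hu hpar => ?_⟩
  · by_cases hjt : j = t
    · subst hjt; simpa using hp
    · rw [hq j (by omega)]; exact h.lt j (by omega)
  · by_cases hat : a = t <;> by_cases hbt : b = t
    · intro; omega
    · subst hat
      rw [hq b (by omega), Function.update_self]
      exact fun hab => absurd ⟨b, by omega, hab.symm⟩ hnot
    · subst hbt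
      rw [hq a (by omega), Function.update_self]
      exact fun hab => absurd ⟨a, by omega, hab⟩ hnot
    · rw [hq a (by omega), hq b (by omega)]
      exact h.inj a (by omega) b (by omega)
  · rw [h.mem_insert_iff]
    exact exists_congr fun j => and_congr_right fun hj => by rw [hq j (by omega)]
  · rw [hmem]
    by_cases hvp : v = par (q i)
    · subst hvp
      exact ⟨fun _ => hr, fun _ => .inl rfl⟩
    · rw [children_insert_iff hvp, ← h.ready v hv, or_iff_right hvp]
  · rw [hq j (by omega)] at hpar
    obtain ⟨j', hj', h'⟩ := h.order_succ hi j hj u hu hpar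
    exact ⟨j', hj', by rw [hq j' (by omega), h']⟩

/-- Process the next node, when its parent does not become ready. -/
lemma pop (h : IsQueue n par q t i P) (hi : i < t)
    (hr : par (q i) < n → ¬ ∀ u < n, par u = par (q i) → u ∈ insert (q i) P) :
    IsQueue n par q t (i + 1) (insert (q i) P) := by
  refine ⟨hi, h.lt, h.inj, h.mem_insert_iff, fun v hv => ?_, h.order_succ hi⟩
  by_cases hvp : v = par (q i)
  · subst hvp
    exact ⟨fun h' => absurd h' (h.parent_notMem hi hv), fun h' => absurd h' (hr hv)⟩
  · rw [children_insert_iff hvp, h.ready v hv]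

end IsQueue

/-- Load the address of the row and the labels of the node in the register `4`. -/
def loadNode : Prog :=
  .set 7 (7 * reg 0 + 2 + 2 * (reg 4 * (reg 1 + 1))) ;;
  .set 9 (mem (reg 0 + reg 4)) ;;
  .set 10 ((reg 9).max 1) ;;
  .set 11 (mem (2 * reg 0 + reg 4))

/-- Load the next node of the queue and its parent. -/
def dequeue : Prog :=
  .set 4 (mem (5 * reg 0 + 1 + (reg 0 - reg 2))) ;;
  .set 5 (mem (reg 4)) ;;
  .set 8 (7 * reg 0 + 2 + 2 * (reg 5 * (reg 1 + 1))) ;;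
  loadNode

/-- Decrease the number of unprocessed children of the parent, and add it to the queue if there are
none left. -/
def release : Prog :=
  .set 6 (mem (4 * reg 0 + reg 5) - 1) ;;
  .store (4 * reg 0 + reg 5) (reg 6) ;;
  .set 2 (reg 2 - 1) ;;
  .ite (reg 6 + (reg 5 + 1 - reg 0)) .skip
    (.store (5 * reg 0 + 1 + reg 3) (reg 5) ;;
     .set 3 (reg 3 + 1))

/-- Process all nodes from the leaves to the root. -/
def bottomUp : Prog :=
  .set 2 (reg 0) ;;
  .loop (reg 2) (dequeue ;; updateTables ;; release)

/-- The sum of `f` over the children of `v` that lie in `P`. -/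
def childSum (par : ℕ → ℕ) (f : ℕ → ℕ → ℕ) (P : Finset ℕ) (v s : ℕ) : ℕ :=
  ∑ u ∈ P with par u = v, f u s

lemma childSum_insert {f : ℕ → ℕ → ℕ} {P : Finset ℕ} {u : ℕ} (hu : u ∉ P) (v s : ℕ) :
    childSum par f (insert u P) v s =
      childSum par f P v s + if par u = v then f u s else 0 := by
  unfold childSum
  rw [Finset.filter_insert]
  split_ifs
  · rw [Finset.sum_insert (by simp [hu]), add_comm]
  · rfl

lemma childSum_mono {f : ℕ → ℕ → ℕ} {P Q : Finset ℕ} (h : P ⊆ Q) (v s : ℕ) :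
    childSum par f P v s ≤ childSum par f Q v s :=
  Finset.sum_le_sum_of_subset (Finset.filter_subset_filter _ h)

lemma card_sdiff_insert {P : Finset ℕ} {u : ℕ} (hu : u < n) (huP : u ∉ P) (v : ℕ) :
    ((Finset.range n \ insert u P).filter fun c => par c = v).card =
      ((Finset.range n \ P).filter fun c => par c = v).card - if par u = v then 1 else 0 := by
  rw [Finset.sdiff_insert, Finset.filter_erase]
  split_ifs with h
  · rw [Finset.card_erase_of_mem (by simp [hu, huP, h])]
  · rw [Finset.erase_eq_of_notMem (by simp [h]), Nat.sub_zero]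

lemma childSum_eq {f : ℕ → ℕ → ℕ} {P : Finset ℕ} {v : ℕ} (hP : P ⊆ Finset.range n)
    (h : ∀ u < n, par u = v → u ∈ P) : childSum par f P v = childSum par f (Finset.range n) v := by
  funext s
  unfold childSum
  congr 1
  ext u
  simp only [Finset.mem_filter, Finset.mem_range]
  exact ⟨fun hu => ⟨Finset.mem_range.1 (hP hu.1), hu.2⟩, fun hu => ⟨h u hu.1 hu.2, hu.2⟩⟩

/-- Invariant: with `P` the set of processed nodes, each cost row is the sum over the children in
`P`, and `deg` counts the children outside `P`. All children of a dequeued node lie in `P`, so its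
row is complete. Partial sums are at most the full ones, so `hbound` prevents overflow. -/
lemma bottomUp_runs {f : ℕ → ℕ → ℕ} {d : ℕ → ℕ} (hn : 1 ≤ n) (hk : 1 ≤ k)
    (hW : 1000 * (k * n) ≤ W) (hpar : ∀ v < n, par v ≤ n)
    (hd : ∀ v < n, par v < n → d (par v) < d v) (ha : ∀ v < n, a v ≤ k) (hb : ∀ v < n, b v ≤ k)
    (hf : ∀ v < n, ∀ s ≤ k, f v s = step k (a v) (b v) (childSum par f (Finset.range n) v) s)
    (hbound : ∀ v ≤ n, ∀ s ≤ k, childSum par f (Finset.range n) v s ≤ k * n)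
    {s : State} (h0 : s.reg 0 = n) (h1 : s.reg 1 = k) (hq : IsQueue n par queue (s.reg 3) 0 ∅)
    (hdeg : ∀ j ≤ n, deg j = ((Finset.range n).filter fun c => par c = j).card)
    (hF : ∀ j ≤ n, ∀ s ≤ k, F j s = 0) (h : Rep n k par a b out deg queue acc F M s.mem) :
    Runs W bottomUp s (1000 * (k * n)) fun s => s.reg 0 = n ∧ s.reg 1 = k ∧
      ∃ deg q F M t P, IsQueue n par q t n P ∧ Rep n k par a b out deg q acc F M s.mem ∧
        ∀ v < n, ∀ s ≤ k, F v s = childSum par f (Finset.range n) v s ∧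
          M v s = sufMin (childSum par f (Finset.range n) v) k s := by
  have hkn : k ≤ k * n := Nat.le_mul_of_pos_right k hn
  have hnk : n ≤ k * n := Nat.le_mul_of_pos_left n hk
  let I : ℕ → State → Prop := fun m s => s.reg 0 = n ∧ s.reg 1 = k ∧ s.reg 2 = m ∧ m ≤ n ∧
    ∃ q M P, IsQueue n par q (s.reg 3) (n - m) P ∧
      Rep n k par a b out (fun j => ((Finset.range n \ P).filter fun c => par c = j).card) q acc
        (childSum par f P) M s.mem ∧
      ∀ v ∈ P, ∀ s ≤ k, M v s = sufMin (childSum par f (Finset.range n) v) k s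
  refine Runs.mono (T := 2 + (n * ((100 + (300 * k + 100)) + 2) + 2)) (Q := I 0)
    (Runs.seq (R := I n) (Runs.of_wp ?_ (by decide)) fun s hs =>
      Runs.countdown I ?_ ?_ n hs)
    (by nlinarith) ?_
  · simp +decide only [Prog.wp, fits_reg, eval_reg, h0]
    refine ⟨by omega, by simp [h0], by simp [h1], by simp, le_rfl, queue, M, ∅, by simpa using hq,
      h.congr (hdeg := fun j hj => by simp [hdeg j hj]) (hF := fun j hj s hs => ?_), by simp⟩
    simp [hF j hj s hs, childSum]
  · exact fun m s hs => ⟨hs.2.2.1, by have := hs.2.2.2.1; omega⟩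
  · rintro m s ⟨h0, h1, h2, hm, q, M, P, hq, h, hM⟩
    have hi : n - (m + 1) < s.reg 3 := hq.lt_length hd (by omega)
    obtain ⟨v, hv⟩ : ∃ v, v = q (n - (m + 1)) := ⟨_, rfl⟩
    obtain ⟨p, hp⟩ : ∃ p, p = par v := ⟨_, rfl⟩
    have hvn : v < n := hv ▸ hq.lt _ hi
    have hpn : p ≤ n := hp ▸ hpar v hvn
    have hvP : v ∉ P := hv ▸ hq.notMem hi
    have hpv : p ≠ v := by
      intro hpv
      have := hd v hvn (by omega)
      rw [← hp, hpv] at this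
      omega
    have hFv : childSum par f P v = childSum par f (Finset.range n) v :=
      childSum_eq hq.subset fun u hu hpu => hq.children_mem hi hu (hv ▸ hpu)
    have hins : insert v P ⊆ Finset.range n :=
      Finset.insert_subset (Finset.mem_range.2 hvn) hq.subset
    have hFp : ∀ t ≤ k, childSum par f P p t + step k (a v) (b v) (childSum par f P v) t =
        childSum par f (insert v P) p t := fun t ht => by
      rw [childSum_insert hvP, if_pos hp.symm, hFv, hf v hvn t ht]
    refine Runs.seq (R := fun s' => (∀ r < 4, s'.reg r = s.reg r) ∧ s'.reg 4 = v ∧ s'.reg 5 = p ∧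
      s'.reg 7 = row n k v ∧ s'.reg 8 = row n k p ∧ s'.reg 9 = a v ∧ s'.reg 10 = max (a v) 1 ∧
      s'.reg 11 = b v ∧ s'.mem = s.mem) (Runs.of_wp ?_ (by decide)) fun s1 hs1 => Runs.seq
      (R := fun s' => (∀ r < 6, s'.reg r = s1.reg r) ∧
        Rep n k par a b out (fun j => ((Finset.range n \ P).filter fun c => par c = j).card) q acc
          (childSum par f (insert v P))
          (Function.update M v (sufMin (childSum par f P v) k)) s'.mem) ?_ fun s2 hs2 => ?_
    · have hrv := row_add_le hn hk hvn.le le_rfl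
      have hrp := row_add_le hn hk hpn le_rfl
      have e1 := h.queue (n - (m + 1)) (by omega)
      rw [← hv] at e1
      have e2 := h.par v hvn
      rw [← hp] at e2
      have e3 := ha v hvn
      have e4 := hb v hvn
      simp +decide only [dequeue, loadNode, Prog.wp, fits_reg, fits_add, fits_sub, fits_mul,
        fits_mem, fits_ofNat, fits_max, eval_max, eval_reg, eval_add, eval_sub, eval_mul, eval_mem,
        eval_ofNat, Function.update_self, ne_eq, Function.update_of_ne, h0, h1, h2, e1, e2,
        h.a v hvn, h.b v hvn]
      unfold row at hrv hrp ⊢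
      and_intros
      any_goals omega
      · intro r hr
        iterate 7 rw [Function.update_of_ne (by omega)]
      all_goals simp
    · obtain ⟨hr, h4, h5, h7, h8, h9, h10, h11, hmem⟩ := hs1
      refine (updateTables_runs hn hk (by omega) hvn.le hpn hpv (ha v hvn) (hb v hvn) ?_ ?_
        ((hr 0 (by omega)).trans h0) ((hr 1 (by omega)).trans h1) h7 h8 h9 h10 h11
        (hmem ▸ h)).mono le_rfl fun s' hs' => ⟨hs'.1, hs'.2.congr (hF := fun j hj t ht => ?_)⟩
      · intro t ht
        rw [hFv]
        exact hbound v hvn.le t ht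
      · intro t ht
        rw [hFp t ht]
        exact (childSum_mono hins p t).trans (hbound p hpn t ht)
      · rw [Function.update_apply]
        split_ifs with hj
        · rw [hj]; exact hFp t ht
        · rw [childSum_insert hvP, if_neg (by omega), add_zero]
    · obtain ⟨hr, h4, h5, -⟩ := hs1
      obtain ⟨hr', h'⟩ := hs2
      have g0 := ((hr' 0 (by omega)).trans (hr 0 (by omega))).trans h0
      have g1 := ((hr' 1 (by omega)).trans (hr 1 (by omega))).trans h1
      have g2 := ((hr' 2 (by omega)).trans (hr 2 (by omega))).trans h2
      have g3 := (hr' 3 (by omega)).trans (hr 3 (by omega))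
      have g5 := (hr' 5 (by omega)).trans h5
      have e1 := h'.deg p hpn
      have e2 := card_sdiff_insert (par := par) hvn hvP p
      rw [if_pos hp.symm] at e2
      have e3 : ((Finset.range n \ P).filter fun c => par c = p).card ≤ n :=
        (Finset.card_le_card ((Finset.filter_subset _ _).trans Finset.sdiff_subset)).trans_eq
          (Finset.card_range n)
      have e4 : ((Finset.range n \ insert v P).filter fun c => par c = p).card = 0 ↔
          ∀ u < n, par u = p → u ∈ insert v P := by
        simp only [Finset.card_eq_zero, Finset.filter_eq_empty_iff, Finset.mem_sdiff,
          Finset.mem_range]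
        exact ⟨fun h u hu hpu => by_contra fun hc => h ⟨hu, hc⟩ hpu,
          fun h u hu hpu => hu.2 (h u hu.1 hpu)⟩
      have e5 : n - m = n - (m + 1) + 1 := by omega
      have h'' := (h'.set_deg hpn (((Finset.range n \ insert v P).filter
        fun c => par c = p).card)).congr (deg' := fun j =>
          ((Finset.range n \ insert v P).filter fun c => par c = j).card) (hdeg := fun j hj => by
            rw [Function.update_apply]
            split_ifs with hj
            · rw [hj]
            · rw [card_sdiff_insert hvn hvP, if_neg (by omega), Nat.sub_zero])
      have hM' : ∀ u ∈ insert v P, ∀ s ≤ k, Function.update M v (sufMin (childSum par f P v) k) u s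
          = sufMin (childSum par f (Finset.range n) u) k s := by
        intro u hu t ht
        by_cases huv : u = v
        · rw [huv, Function.update_self, hFv]
        · rw [Function.update_of_ne huv]
          exact hM u (Finset.mem_of_mem_insert_of_ne hu huv) t ht
      have ht := hq.le_size
      refine Runs.of_wp ?_ (by decide)
      simp +decide only [release, Prog.wp, fits_reg, fits_add, fits_sub, fits_mul,
        fits_mem, fits_ofNat, eval_reg, eval_add, eval_sub, eval_mul, eval_mem,
        eval_ofNat, Function.update_self, ne_eq, Function.update_of_ne, g0, g2, g3, g5, e1, ← e2,
        Nat.add_sub_cancel]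
      -- The test is nonzero if an unprocessed child of `p` remains or if `p = n`; the second
      -- summand keeps the fictitious parent out of the queue.
      have hpop : (((Finset.range n \ insert v P).filter fun c => par c = p).card + (p + 1 - n) ≠ 0)
          → IsQueue n par q (s.reg 3) (n - m) (insert v P) := by
        intro hne
        rw [e5, hv]
        refine hq.pop hi fun hlt hall => hne ?_
        rw [← hv, ← hp] at hlt hall
        have := e4.2 hall
        omega
      have hpush : (((Finset.range n \ insert v P).filter fun c => par c = p).card + (p + 1 - n) = 0)
          → IsQueue n par (Function.update q (s.reg 3) p) (s.reg 3 + 1) (n - m) (insert v P) := by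
        intro he
        rw [e5, hp, hv]
        refine hq.push hi (by rw [← hv, ← hp]; omega) ?_
        rw [← hv, ← hp]
        exact e4.1 (by omega)
      refine ⟨by omega, by omega, by omega, by omega, by omega, fun hne => ?_, fun he => ?_⟩
      · exact ⟨by simp [g0], by simp [g1], by simp, by omega, q, _, _, by simpa [g3] using hpop hne,
          h'', hM'⟩
      · have ht' := (hpush he).le_size
        refine ⟨by omega, by omega, by omega, by simp [g0], by simp [g1], by simp, by omega, _, _, _,
          by simpa using hpush he, h''.set_queue (by omega) p, hM'⟩
  · rintro s ⟨h0, h1, -, -, q, M, P, hq, h, hM⟩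
    rw [Nat.sub_zero] at hq
    have hP : P = Finset.range n :=
      Finset.eq_of_subset_of_card_le hq.subset (by rw [hq.card, Finset.card_range])
    subst hP
    exact ⟨h0, h1, _, q, _, M, _, _, hq, h, fun v hv s hs =>
      ⟨rfl, hM v (Finset.mem_range.2 hv) s hs⟩⟩

/-! ### Choosing the values -/

/-- Load the last unprocessed node of the queue, and the costs of its subtree with the value `0` and
with a positive value at the node. -/
def loadLast : Prog :=
  .set 2 (reg 2 - 1) ;;
  .set 4 (mem (5 * reg 0 + 1 + reg 2)) ;;
  .set 5 (mem (reg 4)) ;;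
  loadNode ;;
  .set 6 (mem (6 * reg 0 + 1 + reg 5)) ;;
  .set 14 ((reg 1).min (reg 6 + reg 10)) ;;
  .set 12 (reg 10 + mem (reg 7 + 2 * reg 14 + 1)) ;;
  .set 13 ((mem (reg 7 + 2 * reg 6)).max (reg 11 - reg 6) + reg 9)

/-- Compute an optimal value of the node. -/
def chooseValue : Prog :=
  .ite (reg 12 - reg 13)
    (.set 16 0 ;; .set 17 0)
    (.set 16 (reg 10) ;; .set 17 (mem (reg 7 + 2 * reg 14) - mem (reg 7 + 2 * reg 14 + 1))) ;;
  .loop (reg 17) (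
    .set 14 (reg 14 + 1) ;;
    .set 16 (reg 16 + 1) ;;
    .set 17 (mem (reg 7 + 2 * reg 14) - mem (reg 7 + 2 * reg 14 + 1)))

/-- Write the value of the node, and the truncated sum of the values of the node and its
ancestors. -/
def saveValue : Prog :=
  .store (3 * reg 0 + reg 4) (reg 16) ;;
  .store (6 * reg 0 + 1 + reg 4) ((reg 1).min (reg 6 + reg 16))

/-- Choose the values of all nodes from the root to the leaves. -/
def topDown : Prog :=
  .set 2 (reg 0) ;;
  .loop (reg 2) (loadLast ;; chooseValue ;; saveValue)

/-- The scan climbs from `u` and keeps `sufMin G k u = j + sufMin G k (u + j)`. It stops once `G`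
equals its suffix minimum at `u + j`, where the minimum is attained. -/
lemma chooseValue_runs {G : ℕ → ℕ} {v x : ℕ} (hn : 1 ≤ n) (hk : 1 ≤ k) (hW : 100 * (k * n) ≤ W)
    (hv : v ≤ n) (ha : a v ≤ k) (hG : ∀ s ≤ k, G s ≤ k * n)
    (hF : ∀ s ≤ k, F v s = G s) (hM : ∀ s ≤ k, M v s = sufMin G k s) {s : State}
    (h7 : s.reg 7 = row n k v) (h10 : s.reg 10 = max (a v) 1)
    (h12 : s.reg 12 = posCost k (a v) G x) (hx : posCost k (a v) G x ≤ W)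
    (h13 : s.reg 13 = zeroCost (a v) (b v) G x) (hx' : zeroCost (a v) (b v) G x ≤ W)
    (h14 : s.reg 14 = min k (x + max (a v) 1))
    (h : Rep n k par a b out deg queue acc F M s.mem) :
    Runs W chooseValue s (300 * k) fun s' => (∀ r < 12, s'.reg r = s.reg r) ∧ s'.mem = s.mem ∧
      IsChoice k (a v) (b v) G x (s'.reg 16) := by
  have hkn : k ≤ k * n := Nat.le_mul_of_pos_right k hn
  obtain ⟨u, hu⟩ : ∃ u, u = min k (x + max (a v) 1) := ⟨_, rfl⟩
  have huk : u ≤ k := hu ▸ min_le_left _ _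
  let I : ℕ → State → Prop := fun m s' => (∀ r < 12, s'.reg r = s.reg r) ∧ s'.mem = s.mem ∧
    s'.reg 17 ≤ k * n ∧
    ((zeroCost (a v) (b v) G x < posCost k (a v) G x ∧ s'.reg 16 = 0 ∧ s'.reg 17 = 0) ∨
    (posCost k (a v) G x ≤ zeroCost (a v) (b v) G x ∧ ∃ j, u + j + m = k ∧
      s'.reg 14 = u + j ∧ s'.reg 16 = max (a v) 1 + j ∧
      s'.reg 17 = G (u + j) - sufMin G k (u + j) ∧ sufMin G k u = j + sufMin G k (u + j)))
  refine Runs.mono (T := 50 + ((k - u) * (50 + (reg 17).cost + 1) + (reg 17).cost + 1))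
    (Runs.seq (R := I (k - u)) (Runs.of_wp ?_ (by decide)) fun s' hs =>
      Runs.loop I ?_ ?_ ?_ (k - u) hs)
    (by simp only [Expr.cost]; omega) fun _ => id
  · have hr := row_add_le hn hk hv huk
    have hGu := hG u huk
    have hsu := sufMin_le G k u
    simp +decide only [Prog.wp, fits_reg, fits_add, fits_sub, fits_mul, fits_mem, fits_ofNat,
      eval_reg, eval_add, eval_sub, eval_mul, eval_mem, eval_ofNat, ne_eq,
      Function.update_of_ne, h7, h10, h12, h13, h14, ← hu, h.F v hv u huk, h.M v hv u huk, hF u huk,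
      hM u huk]
    refine ⟨by omega, fun hne => ⟨by omega, by omega, fun r hr => ?_, rfl, by simp,
      .inl ⟨by omega, by simp, by simp⟩⟩, fun he => ⟨by omega, by omega, fun r hr => ?_, rfl,
      by simp only [Function.update_self]; omega,
      .inr ⟨by omega, 0, by omega, by simp [h14, hu], by simp, by simp, by simp⟩⟩⟩
    all_goals
      dsimp only
      rw [Function.update_of_ne (by omega), Function.update_of_ne (by omega)]
  · intro m s' hs'
    have := hs'.2.2.1
    simp only [fits_reg]
    omega
  · rintro m s' ⟨hr, hm, -, hs'⟩ h0
    refine ⟨hr, hm, hs'.imp (fun h => ⟨h.1, h.2.1⟩) fun ⟨h1, j, h2, h3, h4, h5, h6⟩ =>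
      ⟨h1, j, by omega, h4, ?_⟩⟩
    have := sufMin_le G k (u + j)
    simp only [eval_reg] at h0
    rw [← hu, h6]
    omega
  · clear hs
    rintro m s' ⟨hr, hm, -, ⟨-, -, h⟩ | ⟨h1, j, h2, h3, h4, h5, h6⟩⟩ h0
    · exact absurd h h0
    · simp only [eval_reg] at h0
      -- The scan stops at `k` at the latest, where the suffix minimum is `G k` itself.
      have hlt : u + j < k := by
        by_contra hlt
        obtain h' : u + j = k := by omega
        rw [h5, h', sufMin_self] at h0
        omega
      have hs := sufMin_of_lt (F := G) hlt
      have hle := row_add_le hn hk hv (show u + j + 1 ≤ k from hlt)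
      have hG1 := hG _ (show u + j + 1 ≤ k from hlt)
      have hG2 := sufMin_le G k (u + j + 1)
      have g7 := (hr 7 (by omega)).trans h7
      refine ⟨m - 1, by omega, Runs.of_wp ?_ (by decide)⟩
      simp +decide only [Prog.wp, fits_reg, fits_add, fits_sub, fits_mul, fits_mem, fits_ofNat,
        eval_reg, eval_add, eval_sub, eval_mul, eval_mem, eval_ofNat, Function.update_self, ne_eq,
        Function.update_of_ne, g7, hm, h3, h4, h.F v hv (u + j + 1) hlt, h.M v hv (u + j + 1) hlt,
        hF (u + j + 1) hlt, hM (u + j + 1) hlt]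
      refine ⟨by omega, by omega, by omega, fun r hr' => ?_, rfl,
        by simpa using (Nat.sub_le _ _).trans hG1, .inr ⟨h1, j + 1, by omega, by simp; omega,
          by simp; omega, by simp [add_assoc], ?_⟩⟩
      · dsimp only
        rw [← hr r hr']
        iterate 3 rw [Function.update_of_ne (by omega)]
      · rw [h6, ← add_assoc u]
        omega

/-- Reading the queue backwards reaches each parent before its children, so the truncated sum `acc`
is final at the parent when a child needs it. -/
lemma topDown_runs {G : ℕ → ℕ → ℕ} {P : Finset ℕ} {t : ℕ} (hn : 1 ≤ n) (hk : 1 ≤ k)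
    (hW : 1000 * (k * n) ≤ W) (hpar : ∀ v < n, par v ≤ n) (ha : ∀ v < n, a v ≤ k)
    (hb : ∀ v < n, b v ≤ k) (hG : ∀ v < n, ∀ s ≤ k, G v s ≤ k * n)
    (hFM : ∀ v < n, ∀ s ≤ k, F v s = G v s ∧ M v s = sufMin (G v) k s)
    (hq : IsQueue n par queue t n P) (hacc : acc n = 0) {s : State} (h0 : s.reg 0 = n)
    (h1 : s.reg 1 = k) (h : Rep n k par a b out deg queue acc F M s.mem) :
    Runs W topDown s (1000 * (k * n)) fun s => ∃ w acc, Rep n k par a b w deg queue acc F M s.mem ∧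
      acc n = 0 ∧ ∀ v < n, IsChoice k (a v) (b v) (G v) (acc (par v)) (w v) ∧
        acc v = min k (acc (par v) + w v) := by
  have hkn : k ≤ k * n := Nat.le_mul_of_pos_right k hn
  have hnk : n ≤ k * n := Nat.le_mul_of_pos_left n hk
  have hle := hq.le
  have hlater : ∀ i < n, ∀ j < n, par (queue i) = queue j → i < j := by
    intro i hi j hj hij
    obtain ⟨j', hj', h'⟩ := hq.order j hj _ (hq.lt i (by omega)) hij
    have := hq.inj j' (by omega) i (by omega) h'
    omega
  have hsurj : ∀ v < n, ∃ i < n, queue i = v := by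
    intro v hv
    rw [← hq.mem, Finset.eq_of_subset_of_card_le hq.subset (by rw [hq.card, Finset.card_range])]
    exact Finset.mem_range.2 hv
  let I : ℕ → State → Prop := fun m s => s.reg 0 = n ∧ s.reg 1 = k ∧ s.reg 2 = m ∧ m ≤ n ∧
    ∃ w acc, Rep n k par a b w deg queue acc F M s.mem ∧ acc n = 0 ∧ ∀ i < n, m ≤ i →
      IsChoice k (a (queue i)) (b (queue i)) (G (queue i)) (acc (par (queue i))) (w (queue i)) ∧
        acc (queue i) = min k (acc (par (queue i)) + w (queue i))
  refine Runs.mono (T := 2 + (n * ((100 + (300 * k + 50)) + 2) + 2)) (Q := I 0)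
    (Runs.seq (R := I n) (Runs.of_wp ?_ (by decide)) fun s hs =>
      Runs.countdown I ?_ ?_ n hs)
    (by nlinarith) ?_
  · simp +decide only [Prog.wp, fits_reg, eval_reg, h0]
    exact ⟨by omega, by simp [h0], by simp [h1], by simp, le_rfl, out, acc, h, hacc, by omega⟩
  · exact fun m s hs => ⟨hs.2.2.1, by have := hs.2.2.2.1; omega⟩
  · rintro m s ⟨h0, h1, h2, hm, w, acc, h, hacc, hdone⟩
    obtain ⟨v, hv⟩ : ∃ v, v = queue m := ⟨_, rfl⟩
    obtain ⟨p, hp⟩ : ∃ p, p = par v := ⟨_, rfl⟩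
    have hvn : v < n := hv ▸ hq.lt m (by omega)
    have hpn : p ≤ n := hp ▸ hpar v hvn
    -- For the root, `p = n` and the sum is `0`; any other parent stands later in the queue and has
    -- been treated.
    have hx : acc p ≤ k := by
      rcases hpn.eq_or_lt with h' | h'
      · rw [h', hacc]; omega
      · obtain ⟨j, hj, rfl⟩ := hsurj p h'
        have := hlater m (by omega) j hj (by rw [← hv, ← hp])
        rw [(hdone j hj (by omega)).2]
        exact min_le_left _ _
    have e3 := ha v hvn
    have e4 := hb v hvn
    have e5 := hG v hvn (acc p) hx
    have hu : min k (acc p + max (a v) 1) ≤ k := min_le_left _ _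
    have e6 := (sufMin_le (G v) k _).trans (hG v hvn _ hu)
    have hP : posCost k (a v) (G v) (acc p) ≤ W := by unfold posCost; omega
    have hZ : zeroCost (a v) (b v) (G v) (acc p) ≤ W := by unfold zeroCost; omega
    refine Runs.seq (R := fun s' => s'.reg 0 = n ∧ s'.reg 1 = k ∧ s'.reg 2 = m ∧ s'.reg 4 = v ∧
      s'.reg 6 = acc p ∧ s'.reg 7 = row n k v ∧ s'.reg 10 = max (a v) 1 ∧
      s'.reg 12 = posCost k (a v) (G v) (acc p) ∧
      s'.reg 13 = zeroCost (a v) (b v) (G v) (acc p) ∧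
      s'.reg 14 = min k (acc p + max (a v) 1) ∧ s'.mem = s.mem)
      (Runs.of_wp ?_ (by decide)) fun s1 hs1 => Runs.seq
      (R := fun s' => s'.reg 0 = n ∧ s'.reg 1 = k ∧ s'.reg 2 = m ∧ s'.reg 4 = v ∧
        s'.reg 6 = acc p ∧ s'.mem = s.mem ∧
        IsChoice k (a v) (b v) (G v) (acc p) (s'.reg 16)) ?_ fun s2 hs2 => ?_
    · have hrv := row_add_le hn hk hvn.le le_rfl
      have hru := row_add_le hn hk hvn.le hu
      have hrx := row_add_le hn hk hvn.le hx
      have e1 := h.queue m (by omega)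
      rw [← hv] at e1
      have e2 := h.par v hvn
      rw [← hp] at e2
      have e7 := (h.F v hvn.le _ hx).trans (hFM v hvn _ hx).1
      have e8 := (h.M v hvn.le _ hu).trans (hFM v hvn _ hu).2
      have erow : 7 * n + 2 + 2 * (v * (k + 1)) = row n k v := rfl
      simp +decide only [loadLast, loadNode, Prog.wp, fits_reg, fits_add, fits_sub, fits_mul,
        fits_mem, fits_ofNat, fits_max, eval_max, fits_min, eval_min, eval_reg, eval_add, eval_sub,
        eval_mul, eval_mem, eval_ofNat, Function.update_self, ne_eq, Function.update_of_ne, h0, h1,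
        h2, Nat.add_sub_cancel, e1, e2, h.a v hvn, h.b v hvn, h.acc p hpn, erow, e7, e8]
      have : v * (k + 1) ≤ row n k v := by unfold row; omega
      simp only [zeroCost, posCost] at hZ hP ⊢
      and_intros
      any_goals omega
      all_goals simp
    · obtain ⟨g0, g1, g2, g4, g6, g7, g10, g12, g13, g14, hmem⟩ := hs1
      refine (chooseValue_runs hn hk (by omega) hvn.le e3 (hG v hvn) (fun s hs => (hFM v hvn s hs).1)
        (fun s hs => (hFM v hvn s hs).2) g7 g10 g12 hP g13 hZ g14 (hmem ▸ h)).mono le_rfl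
        fun s' hs' => ?_
      obtain ⟨hr, hm', hc⟩ := hs'
      exact ⟨(hr 0 (by omega)).trans g0, (hr 1 (by omega)).trans g1, (hr 2 (by omega)).trans g2,
        (hr 4 (by omega)).trans g4, (hr 6 (by omega)).trans g6, hm'.trans hmem, hc⟩
    · obtain ⟨g0, g1, g2, g4, g6, hmem, hc⟩ := hs2
      -- A crude bound that serves the word size only.
      have hv16 : s2.reg 16 ≤ 2 * k := by
        rcases hc with hc | ⟨-, j, hj, hc, -⟩ <;> omega
      refine Runs.of_wp ?_ (by decide)
      simp +decide only [saveValue, Prog.wp, fits_reg, fits_add, fits_mul, fits_ofNat, fits_min,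
        eval_min, eval_reg, eval_add, eval_mul, eval_ofNat, g0, g1, g4, g6, hmem]
      refine ⟨by omega, by omega, by omega, by omega, g0, g1, g2, by omega, _, _,
        (h.set_out hvn (s2.reg 16)).set_acc hvn.le _, ?_, fun i hi hmi => ?_⟩
      · rw [Function.update_of_ne (by omega), hacc]
      · have hpi : par (queue i) ≠ v := by
          intro h'
          rw [hv] at h'
          have := hlater i hi m (by omega) h'
          omega
        rw [Function.update_of_ne hpi]
        by_cases him : i = m
        · subst him
          rw [← hv, ← hp]
          simpa using hc
        · have hne : queue i ≠ v := by
            intro h'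
            exact him (hq.inj i (by omega) m (by omega) (h'.trans hv))
          rw [Function.update_of_ne hne, Function.update_of_ne hne]
          exact hdone i hi (by omega)
  · rintro s ⟨h0, h1, -, -, w, acc, h, hacc, hdone⟩
    refine ⟨w, acc, h, hacc, fun v hv => ?_⟩
    obtain ⟨i, hi, rfl⟩ := hsurj v hv
    exact hdone i hi (Nat.zero_le _)

/-! ### The algorithm -/

/-- The algorithm for weak `{k}`-`L`-domination of trivially perfect graphs. -/
def weakDominationProg : Prog := countChildren ;; collectLeaves ;; bottomUp ;; topDown

lemma weakDominationProg_runs {n k W : ℕ} {par par' a b d : ℕ → ℕ} {f : ℕ → ℕ → ℕ} (hn : 1 ≤ n)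
    (hk : 1 ≤ k) (hW : 3000 * (k * n) ≤ W) (hpar : ∀ v < n, par v < n)
    (hpar' : ∀ v < n, par' v = if par v = v then n else par v)
    (hd : ∀ v < n, par' v < n → d (par' v) < d v) (ha : ∀ v < n, a v ≤ k) (hb : ∀ v < n, b v ≤ k)
    (hf : ∀ v < n, ∀ s ≤ k, f v s = step k (a v) (b v) (childSum par' f (Finset.range n) v) s)
    (hbound : ∀ v ≤ n, ∀ s ≤ k, childSum par' f (Finset.range n) v s ≤ k * n)
    {s : State} (h0 : s.reg 0 = n) (h1 : s.reg 1 = k)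
    (h : Rep n k par a b (fun _ => 0) (fun _ => 0) (fun _ => 0) (fun _ => 0) (fun _ _ => 0)
      (fun _ _ => 0) s.mem) :
    Runs W weakDominationProg s (3000 * (k * n)) fun s => ∃ w acc : ℕ → ℕ,
      (∀ v < n, s.mem (3 * n + v) = w v) ∧ acc n = 0 ∧ ∀ v < n,
        IsChoice k (a v) (b v) (childSum par' f (Finset.range n) v) (acc (par' v)) (w v) ∧
        acc v = min k (acc (par' v) + w v) := by
  have hnk : n ≤ k * n := Nat.le_mul_of_pos_left n hk
  have hle : ∀ v < n, par' v ≤ n := by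
    intro v hv
    have := hpar v hv
    rw [hpar' v hv]
    split_ifs <;> omega
  refine Runs.mono (T := 100 * n + (100 * n + (1000 * (k * n) + 1000 * (k * n)))) (Runs.seq
    (countChildren_runs hn (by omega) hpar hpar' (by simp) h0 h1 h) fun s ⟨h0, h1, h⟩ => Runs.seq
    (collectLeaves_runs hn (by omega) (fun j _ => ?_) h0 h1 h)
    fun s ⟨h0, h1, q, h, ht, hq, hinj, hmem⟩ => Runs.seq
    (bottomUp_runs (W := W) (queue := q) hn hk (by omega) hle hd ha hb hf hbound h0 h1
      ⟨Nat.zero_le _, hq, hinj, by simp, fun v hv => ?_, by simp⟩ (fun j _ => rfl) (by simp) h)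
    fun s ⟨h0, h1, deg, q, F, M, t, P, hq, h, hFM⟩ =>
      (topDown_runs (W := W) hn hk (by omega) hle ha hb (fun v hv => hbound v hv.le) hFM hq rfl h0
        h1 h).mono le_rfl fun s ⟨w, acc, h, hacc, hc⟩ => ⟨w, acc, h.out, hacc, hc⟩)
    (by omega) fun _ => id
  · exact (Finset.card_filter_le _ _).trans_eq (Finset.card_range n)
  · rw [hmem v hv]
    simp only [Finset.card_eq_zero, Finset.filter_eq_empty_iff, Finset.mem_range,
      Finset.notMem_empty, imp_false]

/-! ### The tree as an array of parents -/

section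

variable {T : RootedTree} {n : ℕ} (num : T ≃ Fin n)

/-- Extend a function on the nodes to the natural numbers, by a default value. -/
def onNumbers {β : Type*} (g : T → β) (z : β) (j : ℕ) : β :=
  if h : j < n then g (num.symm ⟨j, h⟩) else z

lemma onNumbers_of_lt {β : Type*} (g : T → β) (z : β) {j : ℕ} (h : j < n) :
    onNumbers num g z j = g (num.symm ⟨j, h⟩) := dif_pos h

lemma onNumbers_num {β : Type*} (g : T → β) (z : β) (x : T) :
    onNumbers num g z (num x) = g x := by
  rw [onNumbers_of_lt num g z (num x).2]
  simp

lemma forall_lt_iff {P : ℕ → Prop} : (∀ j < n, P j) ↔ ∀ x : T, P (num x) := by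
  refine ⟨fun h x => h _ (num x).2, fun h j hj => ?_⟩
  simpa using h (num.symm ⟨j, hj⟩)

open Classical in
/-- The number of the parent of a node, where the parent of the root gets the number `n`. -/
noncomputable def parentNumber (x : T) : ℕ := if x = ⊥ then n else num (Order.pred x)

lemma parentNumber_eq_num [Fintype T] {x y : T} : parentNumber num y = num x ↔ y ∈ children x := by
  rw [mem_children, parentNumber]
  split_ifs with h
  · have := (num x).2
    simp [h]
    omega
  · simp [h, Fin.val_inj]

lemma sum_range_filter [Fintype T] (g : ℕ → ℕ) (P : ℕ → Prop) [DecidablePred P] :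
    ∑ j ∈ Finset.range n with P j, g j = ∑ x : T with P (num x), g (num x) := by
  rw [Finset.sum_filter, Finset.sum_filter, ← Fin.sum_univ_eq_sum_range fun j =>
    if P j then g j else 0]
  exact (Equiv.sum_comp num fun j : Fin n => if P j then g j else 0).symm

lemma childSum_num [Fintype T] (f : T → ℕ → ℕ) (x : T) :
    childSum (onNumbers num (parentNumber num) 0) (onNumbers num f 0) (Finset.range n) (num x) =
      fun s => ∑ c ∈ children x, f c s := by
  funext s
  rw [childSum, sum_range_filter num]
  simp only [onNumbers_num, parentNumber_eq_num]
  congr 1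
  ext y
  simp [onNumbers_num, parentNumber_eq_num]

/-- Only the root has the fictitious parent, so row `n` ends up with the cost of the whole tree. -/
lemma childSum_last [Fintype T] (f : T → ℕ → ℕ) (s : ℕ) :
    childSum (onNumbers num (parentNumber num) 0) (onNumbers num f 0) (Finset.range n) n s =
      f ⊥ s := by
  classical
  rw [childSum, sum_range_filter num]
  simp only [onNumbers_num]
  rw [show (Finset.univ.filter fun x : T => parentNumber num x = n) = {⊥} by
    ext x
    have := (num (Order.pred x)).2
    rw [Finset.mem_filter_univ, Finset.mem_singleton, parentNumber]
    split_ifs with h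
    · simp [h]
    · simp only [h, iff_false]
      omega]
  simp

end

/-! ### From the input to a run of the algorithm -/

lemma rep_inputState (T : RootedTree) [Fintype T] {n : ℕ} (num : T ≃ Fin n) (k : ℕ)
    (L : T → Fin (k + 1) × Fin (k + 1)) :
    Rep n k (onNumbers num (fun x => (num (Order.pred x) : ℕ)) 0)
      (onNumbers num (fun x => ((L x).1 : ℕ)) 0) (onNumbers num (fun x => ((L x).2 : ℕ)) 0)
      (fun _ => 0) (fun _ => 0) (fun _ => 0) (fun _ => 0) (fun _ _ => 0) (fun _ _ => 0)
      (inputState T num k L).mem := by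
  -- Memory beyond the input is `0`, so the counters and cost rows need no initialization.
  have hz : ∀ j, 3 * n ≤ j → (inputState T num k L).mem j = 0 := by
    intro j hj
    refine List.getD_eq_default _ _ ?_
    simp only [List.length_append, List.length_ofFn]
    omega
  refine ⟨fun j hj => ?_, fun j hj => ?_, fun j hj => ?_, fun j _ => hz _ (by omega),
    fun j _ => hz _ (by omega), fun j _ => hz _ (by omega), fun j _ => hz _ (by omega),
    fun j _ s _ => hz _ (by unfold row; omega), fun j _ s _ => hz _ (by unfold row; omega)⟩
  all_goals
    rw [onNumbers_of_lt num _ _ hj]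
    simp only [inputState]
  · rw [List.append_assoc, List.getD_append _ _ _ _ (by simpa using hj)]
    rw [List.getD_eq_getElem _ _ (by simpa using hj)]
    simp
  · rw [List.getD_append _ _ _ _ (by simp; omega),
      List.getD_append_right _ _ _ _ (by simp), List.getD_eq_getElem _ _ (by simp; omega)]
    simp
  · rw [List.getD_append_right _ _ _ _ (by simp; omega),
      List.getD_eq_getElem _ _ (by simp; omega)]
    simp [show 2 * n + j - (n + n) = j by omega]

lemma weakDominationProg_inputState {T : RootedTree} [Fintype T] {n k : ℕ} (num : T ≃ Fin n)
    (hn : 1 ≤ n) (hk : 1 ≤ k) (L : T → Fin (k + 1) × Fin (k + 1)) {f : T → ℕ → ℕ}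
    (hf : ∀ x, f x = step k (L x).1 (L x).2 fun s => ∑ c ∈ children x, f c s) :
    Runs (3000 * (k * n)) weakDominationProg (inputState T num k L) (3000 * (k * n)) fun s =>
      ∃ w acc : ℕ → ℕ, (∀ x : T, s.mem (3 * n + num x) = w (num x)) ∧ acc n = 0 ∧ ∀ x : T,
        IsChoice k (L x).1 (L x).2 (fun s => ∑ c ∈ children x, f c s) (acc (parentNumber num x))
          (w (num x)) ∧
        acc (num x) = min k (acc (parentNumber num x) + w (num x)) := by
  have hcard : Fintype.card T = n := by simpa using Fintype.card_congr num
  have ha : ∀ x, ((L x).1 : ℕ) ≤ k := fun x => Nat.lt_succ_iff.1 (L x).1.2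
  have hb : ∀ x, ((L x).2 : ℕ) ≤ k := fun x => Nat.lt_succ_iff.1 (L x).2.2
  refine (weakDominationProg_runs
    (par' := onNumbers num (parentNumber num) 0) (f := onNumbers num f 0)
    -- The depth of a node is its number of proper ancestors.
    (d := onNumbers num (ancestorSum fun _ => 1) 0)
    hn hk le_rfl ?_ ?_ ?_ ?_ ?_ ?_ ?_ (s := inputState T num k L) rfl rfl
    (rep_inputState T num k L)).mono le_rfl fun s ⟨w, acc, hw, hacc, hc⟩ =>
      ⟨w, acc, (forall_lt_iff num).1 hw, hacc, fun x => ?_⟩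
  · rw [forall_lt_iff num]
    intro x
    rw [onNumbers_num]
    exact (num (Order.pred x)).2
  · rw [forall_lt_iff num]
    intro x
    rw [onNumbers_num, onNumbers_num, parentNumber]
    by_cases hx : x = ⊥
    · rw [if_pos hx, if_pos (by simp [hx])]
    · rw [if_neg hx, if_neg]
      rw [Fin.val_inj, num.injective.eq_iff]
      exact (Order.pred_lt_of_not_isMin (by simpa [isMin_iff_eq_bot] using hx)).ne
  · rw [forall_lt_iff num]
    intro x
    rw [onNumbers_num]
    intro h
    obtain ⟨y, hy⟩ : ∃ y, parentNumber num x = num y := ⟨num.symm ⟨_, h⟩, by simp⟩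
    rw [hy, onNumbers_num, onNumbers_num, ancestorSum_child _ ((parentNumber_eq_num num).1 hy)]
    exact Nat.lt_succ_self _
  · rw [forall_lt_iff num]
    intro x
    rw [onNumbers_num]
    exact ha x
  · rw [forall_lt_iff num]
    intro x
    rw [onNumbers_num]
    exact hb x
  · rw [forall_lt_iff num]
    intro x s _
    rw [onNumbers_num, onNumbers_num, onNumbers_num, childSum_num, hf x]
  · intro v hv s hs
    rcases hv.eq_or_lt with rfl | hv
    · rw [childSum_last]
      exact (recursion_le hf hk ha hs ⊥).trans
        (Nat.mul_le_mul_left k ((subtreeSum_one_le _).trans_eq hcard))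
    · obtain ⟨x, rfl⟩ : ∃ x, v = num x := ⟨num.symm ⟨v, hv⟩, by simp⟩
      rw [childSum_num, ← hcard]
      exact recursion_sum_le hf hk ha hs x
  · have := hc (num x) (num x).2
    rwa [onNumbers_num, onNumbers_num, onNumbers_num, childSum_num] at this

/-- Truncation at `k` may be applied after each addition or once at the end; induction from the root
downwards. -/
lemma acc_parentNumber_eq {T : RootedTree} [Fintype T] {n k : ℕ} (num : T ≃ Fin n)
    {w acc : ℕ → ℕ} (hacc : acc n = 0)
    (h : ∀ x : T, acc (num x) = min k (acc (parentNumber num x) + w (num x))) (x : T) :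
    acc (parentNumber num x) = min k (ancestorSum (fun y => w (num y)) x) := by
  induction x using WellFoundedLT.induction with
  | ind x ih =>
    by_cases hx : x = ⊥
    · rw [parentNumber, if_pos hx, hacc, hx, ancestorSum_bot, Nat.min_zero]
    · have hc : x ∈ children (Order.pred x) := mem_children.2 ⟨hx, rfl⟩
      rw [(parentNumber_eq_num num).2 hc, h, ih _ (lt_of_mem_children hc), ancestorSum_child _ hc]
      omega

end WeakDom

open WeakDom RAM in
theorem mainTheorem4 :
    ∃ (p : RAM.Prog) (C : ℕ),
      ∀ (k : ℕ), 1 ≤ k →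
      ∀ (T : RootedTree) [Fintype T] (n : ℕ) (num : T ≃ Fin n) (G : SimpleGraph T),
        G.IsTriviallyPerfect → T.IsModelOf G →
        ∀ (L : T → Fin (k + 1) × Fin (k + 1)),
          ∃ (t : ℕ) (s : RAM.State) (w : T → Fin (k + 1)),
            RAM.Exec (C * (k * n)) p (inputState T num k L) t s ∧
            t ≤ C * (k * n) ∧
            IsOutput num w s ∧
            IsWeakLDominating G L w ∧
            domCost w = weakLDominationNumber G L := by
  refine ⟨weakDominationProg, 3000, fun k hk T _ n num G _ hG L => ?_⟩
  have hn : 1 ≤ n := by have := (num ⊥).2; omega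
  have hcard : Fintype.card T = n := by simpa using Fintype.card_congr num
  obtain ⟨f, hf⟩ := exists_recursion k (fun x : T => ((L x).1 : ℕ)) fun x => ((L x).2 : ℕ)
  obtain ⟨t, s, h1, h2, w, acc, hw, hacc, hc⟩ := weakDominationProg_inputState num hn hk L hf
  have hacc' := acc_parentNumber_eq num hacc fun x => (hc x).2
  -- An optimal choice never exceeds `k`, so the stored numbers define a function to `Fin (k + 1)`.
  have hle : ∀ x, w (num x) ≤ k := fun x =>
    ((hc x).1.spec (recursion_sum_antitone hf x) hk (Nat.lt_succ_iff.1 (L x).1.2)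
      (hacc' x ▸ min_le_left _ _)).2.1
  refine ⟨t, s, fun x => ⟨w (num x), Nat.lt_succ_of_le (hle x)⟩, h1, h2, hw,
    optimal_of_isChoice hG hk L hf _ fun x => ?_⟩
  have := (hc x).1
  rwa [hacc'] at this
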